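/- For $\alpha,\beta>-1$ and $n\in\{0,1,2,\dots\}$ let $P_n^{\alpha,\beta}$ be the Jacobi polynomial, i.e. the polynomial given for $-1<x<1$ by the Rodrigues formula $$P_n^{\alpha,\beta}(x)=\frac{(-1)^n}{2^n n!}(1-x)^{-\alpha}(1+x)^{-\beta}\frac{d^n}{dx^n}\Big[(1-x)^{\alpha+n}(1+x)^{\beta+n}\Big],$$ let $h_n^{\alpha,\beta}=\int_{-1}^1 [P_n^{\alpha,\beta}(x)]^2(1-x)^\alpha(1+x)^\beta\,dx$, and for $t>0$ and $x,y\in[-1,1]$ let $$G_t^{\alpha,\beta}(x,y)=\sum_{n=0}^\infty e^{-t\,n(n+\alpha+\beta+1)}\,\frac{P_n^{\alpha,\beta}(x)P_n^{\alpha,\beta}(y)}{h_n^{\alpha,\beta}}$$ be the Jacobi heat kernel; write $G_t^{\lambda}=G_t^{\lambda,\lambda}$ for the ultraspherical heat kernel. For $\alpha>-1/2$ let $\Pi_\alpha$ be the probability measure on $[-1,1]$ with $$d\Pi_\alpha(u)=\frac{\Gamma(\alpha+1)}{\sqrt\pi\,\Gamma(\alpha+1/2)}(1-u^2)^{\alpha-1/2}\,du,$$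 and let $\Pi_{-1/2}=\frac12(\delta_{-1}+\delta_1)$. Theorem (reduction formula). Let $\alpha,\beta\ge-1/2$. Then, for all $\theta,\varphi\in[0,\pi]$ and $t>0$, $$G_t^{\alpha,\beta}(\cos\theta,\cos\varphi)=\mathcal C_{\alpha,\beta}\iint G_{t/4}^{\alpha+\beta+1/2}\Big(u\sin\frac\theta2\sin\frac\varphi2+v\cos\frac\theta2\cos\frac\varphi2,\,1\Big)\,d\Pi_\alpha(u)\,d\Pi_\beta(v),$$ where $$\mathcal C_{\alpha,\beta}=\frac{\sqrt\pi\,\Gamma(\alpha+\beta+3/2)}{2^{\alpha+\beta+1}\,\Gamma(\alpha+1)\,\Gamma(\beta+1)};$$ here the series defining the kernels on both sides converge absolutely, and the integrand is integrable with respect to $\Pi_\alpha\otimes\Pi_\beta$. -/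

import Mathlib

open MeasureTheory

noncomputable section

/-- The right-hand side of the Rodrigues formula for the Jacobi polynomial `P_n^{α,β}`,
meaningful for `-1 < x < 1`. -/
def jacobiRodrigues (α β : ℝ) (n : ℕ) (x : ℝ) : ℝ :=
  (-1) ^ n / (2 ^ n * (n.factorial : ℝ)) * (1 - x) ^ (-α) * (1 + x) ^ (-β) *
    iteratedDeriv n (fun y : ℝ => (1 - y) ^ (α + n) * (1 + y) ^ (β + n)) x

/-- The Jacobi polynomial `P_n^{α,β}`: the polynomial that is given on `(-1, 1)` by the
Rodrigues formula (see `jacobiP_eval_eq_rodrigues`), written out by Leibniz's rule. -/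
def jacobiP (α β : ℝ) (n : ℕ) : Polynomial ℝ :=
  Polynomial.C ((-1) ^ n / (2 ^ n * (n.factorial : ℝ))) *
    ∑ k ∈ Finset.range (n + 1),
      Polynomial.C ((n.choose k : ℝ) * (-1) ^ k * (descPochhammer ℝ k).eval (α + n) *
        (descPochhammer ℝ (n - k)).eval (β + n)) *
      ((1 - Polynomial.X) ^ (n - k) * (1 + Polynomial.X) ^ k)

/-- `jacobiP α β n` satisfies the Rodrigues formula on `(-1, 1)`; as two polynomials that agree
on `(-1, 1)` are equal, this determines it. -/
theorem jacobiP_eval_eq_rodrigues (α β : ℝ) (n : ℕ) {x : ℝ} (hx : x ∈ Set.Ioo (-1 : ℝ) 1) :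
    (jacobiP α β n).eval x = jacobiRodrigues α β n x := by
  have h1 : 0 < 1 - x := by linarith [hx.2]
  have h2 : 0 < 1 + x := by linarith [hx.1]
  have c1 : ContDiffAt ℝ n (fun y : ℝ => (1 - y) ^ (α + n)) x :=
    (contDiffAt_const.sub contDiffAt_id).rpow_const_of_ne h1.ne'
  have c2 : ContDiffAt ℝ n (fun y : ℝ => (1 + y) ^ (β + n)) x :=
    (contDiffAt_const.add contDiffAt_id).rpow_const_of_ne h2.ne'
  have d1 : ∀ k : ℕ, iteratedDeriv k (fun y : ℝ => (1 - y) ^ (α + n)) x =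
      (-1) ^ k * ((descPochhammer ℝ k).eval (α + n) * (1 - x) ^ (α + n - k)) := by
    intro k
    rw [iteratedDeriv_comp_const_sub k (fun z : ℝ => z ^ (α + n)) 1]
    simp only [iteratedDeriv_eq_iterate, Real.iter_deriv_rpow_const, smul_eq_mul]
  have d2 : ∀ k : ℕ, iteratedDeriv k (fun y : ℝ => (1 + y) ^ (β + n)) x =
      (descPochhammer ℝ k).eval (β + n) * (1 + x) ^ (β + n - k) := by
    intro k
    rw [iteratedDeriv_comp_const_add k (fun z : ℝ => z ^ (β + n)) 1]
    simp only [iteratedDeriv_eq_iterate, Real.iter_deriv_rpow_const]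
  rw [jacobiRodrigues, iteratedDeriv_fun_mul c1 c2, jacobiP, Polynomial.eval_mul,
    Polynomial.eval_C, Polynomial.eval_finsetSum, mul_assoc, mul_assoc]
  congr 1
  rw [Finset.mul_sum, Finset.mul_sum]
  refine Finset.sum_congr rfl fun k hk => ?_
  have hkn : k ≤ n := Nat.lt_succ_iff.mp (Finset.mem_range.mp hk)
  have e1 : (1 - x) ^ (α + n - k) = (1 - x) ^ α * (1 - x) ^ (n - k) := by
    rw [← Real.rpow_natCast, ← Real.rpow_add h1, Nat.cast_sub hkn]
    ring_nf
  have e2 : (1 + x) ^ (β + n - ((n - k : ℕ) : ℝ)) = (1 + x) ^ β * (1 + x) ^ k := by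
    rw [← Real.rpow_natCast, ← Real.rpow_add h2, Nat.cast_sub hkn]
    ring_nf
  have f1 : (1 - x) ^ (-α) * (1 - x) ^ α = 1 := by
    rw [← Real.rpow_add h1]; simp
  have f2 : (1 + x) ^ (-β) * (1 + x) ^ β = 1 := by
    rw [← Real.rpow_add h2]; simp
  rw [d1, d2, e1, e2]
  simp only [Polynomial.eval_mul, Polynomial.eval_C, Polynomial.eval_pow, Polynomial.eval_sub,
    Polynomial.eval_add, Polynomial.eval_one, Polynomial.eval_X]
  linear_combination (-((n.choose k : ℝ) * (-1) ^ k * (descPochhammer ℝ k).eval (α + n) *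
    (descPochhammer ℝ (n - k)).eval (β + n) * (1 - x) ^ (n - k) * (1 + x) ^ k)) *
    (((1 + x) ^ (-β) * (1 + x) ^ β) * f1 + f2)

/-- `h_n^{α,β}`, the squared norm of `P_n^{α,β}` in `L²((1-x)^α (1+x)^β dx)` on `[-1, 1]`. -/
def jacobiH (α β : ℝ) (n : ℕ) : ℝ :=
  ∫ x in (-1 : ℝ)..1, (jacobiP α β n).eval x ^ 2 * ((1 - x) ^ α * (1 + x) ^ β)

/-- The `n`-th term of the series that defines the Jacobi heat kernel. -/
def jacobiHeatTerm (α β t x y : ℝ) (n : ℕ) : ℝ :=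
  Real.exp (-t * (n * (n + α + β + 1))) *
    ((jacobiP α β n).eval x * (jacobiP α β n).eval y / jacobiH α β n)

/-- The Jacobi heat kernel `G_t^{α,β}(x, y)`. -/
def jacobiHeatKernel (α β t x y : ℝ) : ℝ :=
  ∑' n : ℕ, jacobiHeatTerm α β t x y n

/-- The probability measure `Π_α` on `[-1, 1]`, for `α ≥ -1/2`. -/
def jacobiPi (α : ℝ) : Measure ℝ :=
  if α = -1 / 2 then
    (2⁻¹ : ENNReal) • (Measure.dirac (-1) + Measure.dirac 1)
  else
    (volume.restrict (Set.Icc (-1) 1)).withDensity fun u =>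
      ENNReal.ofReal (Real.Gamma (α + 1) / (Real.sqrt Real.pi * Real.Gamma (α + 1 / 2)) *
        (1 - u ^ 2) ^ (α - 1 / 2))

/-- The constant `C_{α,β}` of the reduction formula. -/
def reductionConst (α β : ℝ) : ℝ :=
  Real.sqrt Real.pi * Real.Gamma (α + β + 3 / 2) /
    (2 ^ (α + β + 1) * Real.Gamma (α + 1) * Real.Gamma (β + 1))

/-- The point `u sin(θ/2) sin(φ/2) + v cos(θ/2) cos(φ/2)`. -/
def reductionPoint (θ φ u v : ℝ) : ℝ :=
  u * Real.sin (θ / 2) * Real.sin (φ / 2) + v * Real.cos (θ / 2) * Real.cos (φ / 2)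

end

/-! Put l = α + β + 1/2. The degree 2n eigenvalue for (l, l) is 2n(2n + 2l + 1) = 4n(n + α + β + 1),
so at time t/4 its exponential is that of degree n for (α, β) at time t. The formula is therefore
proved term by term: odd degrees integrate to 0 by parity, and even degrees obey a product formula
(`integral_jacobiP_even`) turning the integral of P_{2n}^{l,l} into a constant times P_n^{α,β}(cos
θ) P_n^{α,β}(cos φ).

The product formula rests on the sums `homSum`. The hypergeometric operator L sends the sum of index
m + 1 to (y + w) times the sum of index m, plus a multiple of itself (`hypOp_homSum_succ`). For y +
w = 0 the sum is an eigenfunction, namely the Jacobi polynomial. For y + w = 1 a suitable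
combination telescopes to an eigenfunction in x. Polynomial eigenfunctions of L are determined by
their value at 0, which gives the bilinear identity `sum_homSum_eq`. The quadratic transformation
writes P_{2n}^{l,l}(z) in powers of z², and the moments of Π_α ⊗ Π_β turn each power into one of
these sums (`integral_add_pow_jacobiPi_even`).

The norms h_n come from beta integrals, and the constants match by duplication formulas
(`reductionConst_mul_div_jacobiH`). A crude bound on the terms, uniform in the space variables,
gives convergence and the interchange of sum and integral. -/

/-- The rising factorial `a (a + 1) ⋯ (a + n - 1)`. -/
noncomputable def poch (a : ℝ) (n : ℕ) : ℝ := (ascPochhammer ℝ n).eval a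

/-! ### Rising factorials. -/

section Poch

theorem poch_zero (a : ℝ) : poch a 0 = 1 := by simp [poch]

theorem poch_succ (a : ℝ) (n : ℕ) : poch a (n + 1) = poch a n * (a + n) := by
  simp [poch, ascPochhammer_succ_eval]

theorem poch_pos {a : ℝ} (ha : 0 < a) (n : ℕ) : 0 < poch a n := ascPochhammer_pos n a ha

theorem poch_ne_zero {a : ℝ} (ha : 0 < a) (n : ℕ) : poch a n ≠ 0 := (poch_pos ha n).ne'

theorem poch_add (a : ℝ) (m n : ℕ) : poch a (m + n) = poch a m * poch (a + m) n := by
  induction n with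
  | zero => simp [poch_zero]
  | succ n ih => rw [← add_assoc, poch_succ, poch_succ, ih]; push_cast; ring

theorem poch_two_mul (a : ℝ) (n : ℕ) :
    poch (2 * a) (2 * n) = 4 ^ n * poch a n * poch (a + 1 / 2) n := by
  induction n with
  | zero => simp [poch_zero]
  | succ n ih =>
    rw [show 2 * (n + 1) = 2 * n + 1 + 1 by ring, poch_succ, poch_succ, ih, poch_succ, poch_succ]
    push_cast; ring

theorem poch_half (n : ℕ) : poch (1 / 2) n * (4 ^ n * n.factorial) = (2 * n).factorial := by
  induction n with
  | zero => simp [poch_zero]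
  | succ n ih =>
    rw [show 2 * (n + 1) = 2 * n + 1 + 1 by ring, Nat.factorial_succ, Nat.factorial_succ,
      Nat.factorial_succ, poch_succ]
    push_cast
    rw [← ih]; ring

theorem poch_descPochhammer (a : ℝ) {k n : ℕ} (h : k ≤ n) :
    poch (a + 1) (n - k) * (descPochhammer ℝ k).eval (a + n) = poch (a + 1) n := by
  induction k with
  | zero => simp
  | succ k ih =>
    rw [← ih (by omega), descPochhammer_succ_eval, show n - k = n - (k + 1) + 1 by omega,
      poch_succ, Nat.cast_sub h]
    push_cast; ring

theorem poch_le {a b : ℝ} (ha : 0 ≤ a) {n : ℕ} (hb : a + n ≤ b) : poch a n ≤ b ^ n := by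
  induction n with
  | zero => simp [poch_zero]
  | succ n ih =>
    push_cast at hb
    rw [poch_succ, pow_succ]
    have h0 : 0 ≤ b := by have : (0:ℝ) ≤ n := n.cast_nonneg
                          linarith
    exact mul_le_mul (ih (by linarith)) (by linarith) (by positivity) (by positivity)

theorem le_poch {a b : ℝ} (hb : 0 ≤ b) (hab : b ≤ a) (n : ℕ) : b ^ n ≤ poch a n := by
  induction n with
  | zero => simp [poch_zero]
  | succ n ih =>
    rw [poch_succ, pow_succ]
    have : (0:ℝ) ≤ n := n.cast_nonneg
    exact mul_le_mul ih (by linarith) hb ((pow_nonneg hb n).trans ih)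

end Poch

/-! ### The hypergeometric operator and its action on homogeneous sums. -/

section HypergeometricOperator

open Polynomial Finset

/-- The hypergeometric differential operator `X (1 - X) p'' + (c - (c + c') X) p'`. -/
noncomputable def hypOp (c c' : ℝ) : ℝ[X] →ₗ[ℝ] ℝ[X] :=
  LinearMap.mulLeft ℝ (X * (1 - X)) ∘ₗ derivative ∘ₗ derivative +
    LinearMap.mulLeft ℝ (C c - C (c + c') * X) ∘ₗ derivative

theorem hypOp_apply (c c' : ℝ) (p : ℝ[X]) : hypOp c c' p =
    X * (1 - X) * derivative (derivative p) + (C c - C (c + c') * X) * derivative p := rfl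

theorem hypOp_coeff (c c' : ℝ) (p : ℝ[X]) (i : ℕ) :
    (hypOp c c' p).coeff i =
      (i + 1) * (i + c) * p.coeff (i + 1) - i * (i - 1 + (c + c')) * p.coeff i := by
  have h : hypOp c c' p = X * derivative (derivative p) - X * (X * derivative (derivative p)) +
      (C c * derivative p - C (c + c') * (X * derivative p)) := by
    rw [hypOp_apply]; ring
  rw [h]
  generalize c + c' = K
  rcases i with _ | _ | i
  · simp [coeff_derivative]
  · simp [coeff_derivative, coeff_X_mul]; ring
  · simp [coeff_derivative, coeff_X_mul]; ring

theorem coeff_succ_of_hypOp {c c' e : ℝ} {p : ℝ[X]} (h : hypOp c c' p = C e * p) (i : ℕ) :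
    (i + 1) * (i + c) * p.coeff (i + 1) = (i * (i - 1 + (c + c')) + e) * p.coeff i := by
  have := hypOp_coeff c c' p i
  rw [h, coeff_C_mul] at this
  linarith

/-- In the recursion for the coefficients, the factor (i + 1)(i + c) never vanishes when c > 0, so
the constant coefficient determines all the others. -/
theorem eq_zero_of_hypOp {c c' e : ℝ} (hc : 0 < c) {p : ℝ[X]} (h : hypOp c c' p = C e * p)
    (h0 : p.eval 0 = 0) : p = 0 := by
  ext i
  rw [coeff_zero]
  induction i with
  | zero => rwa [coeff_zero_eq_eval_zero]
  | succ i ih =>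
    have := coeff_succ_of_hypOp h i
    rw [ih, mul_zero] at this
    have h1 : ((i : ℝ) + 1) * (i + c) ≠ 0 := by positivity
    exact (mul_eq_zero.mp this).resolve_left h1

/-- An eigenspace of the hypergeometric operator on polynomials is at most one-dimensional. -/
theorem eval_mul_eval_of_hypOp {c c' e : ℝ} (hc : 0 < c) {p q : ℝ[X]}
    (hp : hypOp c c' p = C e * p) (hq : hypOp c c' q = C e * q) (x : ℝ) :
    p.eval x * q.eval 0 = q.eval x * p.eval 0 := by
  have h : C (q.eval 0) * p - C (p.eval 0) * q = 0 := by
    apply eq_zero_of_hypOp (c := c) (c' := c') (e := e) hc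
    · rw [map_sub, ← smul_eq_C_mul, ← smul_eq_C_mul, map_smul, map_smul, hp, hq]
      simp only [smul_eq_C_mul]; ring
    · simp; ring
  have := congrArg (eval x) h
  simp at this
  linarith

/-- The truncated exponents at j = 0 or k = 0 are harmless, since their coefficients vanish there.
-/
theorem hypOp_X_pow_mul (c c' : ℝ) (j k : ℕ) :
    hypOp c c' (X ^ j * (1 - X) ^ k) =
      C (j * (j - 1 + c)) * (X ^ (j - 1) * (1 - X) ^ k) +
      C (k * (k - 1 + c')) * (X ^ j * (1 - X) ^ (k - 1)) -
      C ((j + k) * (j + k - 1 + (c + c'))) * (X ^ j * (1 - X) ^ k) := by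
  rw [hypOp_apply]
  rcases j with _ | _ | j <;> rcases k with _ | _ | k <;>
    simp [derivative_pow] <;> ring

/-- The homogeneous sums `∑_{j + k = m} y^j w^k X^j (1 - X)^k / (j! k! (c)_j (c')_k)`. -/
noncomputable def homSum (c c' y w : ℝ) (m : ℕ) : ℝ[X] :=
  ∑ p ∈ antidiagonal m,
    C (y ^ p.1 * w ^ p.2 / (p.1.factorial * p.2.factorial * (poch c p.1 * poch c' p.2))) *
      (X ^ p.1 * (1 - X) ^ p.2)

theorem hypOp_homSum_zero (c c' y w : ℝ) : hypOp c c' (homSum c c' y w 0) = 0 := by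
  simp [homSum, hypOp_apply, poch_zero]

/-- The coefficients are normalised so that lowering j costs exactly a factor y and lowering k
exactly a factor w; both lowered sums are then the sum of index m. -/
theorem hypOp_homSum_succ {c c' : ℝ} (hc : 0 < c) (hc' : 0 < c') (y w : ℝ) (m : ℕ) :
    hypOp c c' (homSum c c' y w (m + 1)) =
      C (y + w) * homSum c c' y w m -
        C ((m + 1) * (m + (c + c'))) * homSum c c' y w (m + 1) := by
  set a : ℕ → ℕ → ℝ := fun j k =>
    y ^ j * w ^ k / (j.factorial * k.factorial * (poch c j * poch c' k)) with ha
  have hS : ∀ m, homSum c c' y w m =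
      ∑ p ∈ antidiagonal m, C (a p.1 p.2) * (X ^ p.1 * (1 - X) ^ p.2) := fun m => rfl
  have h1 : ∀ j k : ℕ, a (j + 1) k * ((j + 1 : ℕ) * ((j + 1 : ℕ) - 1 + c)) = y * a j k := by
    intro j k
    have e1 := poch_ne_zero hc j
    have e2 := poch_ne_zero hc' k
    have e3 : c + j ≠ 0 := by positivity
    simp only [ha, Nat.factorial_succ, poch_succ]
    push_cast
    have e4 : (j : ℝ) + 1 ≠ 0 := by positivity
    field_simp
    ring
  have h2 : ∀ j k : ℕ, a j (k + 1) * ((k + 1 : ℕ) * ((k + 1 : ℕ) - 1 + c')) = w * a j k := by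
    intro j k
    have e1 := poch_ne_zero hc j
    have e2 := poch_ne_zero hc' k
    have e3 : c' + k ≠ 0 := by positivity
    simp only [ha, Nat.factorial_succ, poch_succ]
    push_cast
    have e4 : (k : ℝ) + 1 ≠ 0 := by positivity
    field_simp
    ring
  have e : hypOp c c' (homSum c c' y w (m + 1)) =
      ∑ p ∈ antidiagonal (m + 1),
        C (a p.1 p.2 * (p.1 * (p.1 - 1 + c))) * (X ^ (p.1 - 1) * (1 - X) ^ p.2) +
      ∑ p ∈ antidiagonal (m + 1),
        C (a p.1 p.2 * (p.2 * (p.2 - 1 + c'))) * (X ^ p.1 * (1 - X) ^ (p.2 - 1)) -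
      C ((m + 1) * (m + (c + c'))) * homSum c c' y w (m + 1) := by
    rw [hS, map_sum, mul_sum, ← sum_add_distrib, ← sum_sub_distrib]
    refine sum_congr rfl fun p hp => ?_
    have hp' : (p.1 : ℝ) + p.2 = m + 1 := by exact_mod_cast mem_antidiagonal.mp hp
    rw [← smul_eq_C_mul, map_smul, hypOp_X_pow_mul, hp', smul_eq_C_mul, smul_eq_C_mul,
      show (m : ℝ) + 1 - 1 + (c + c') = m + (c + c') by ring]
    simp only [C_mul]
    ring
  -- The j = 0 term leaves the first sum and the k = 0 term the second; both have coefficient 0.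
  rw [e, Nat.sum_antidiagonal_succ, Nat.sum_antidiagonal_succ']
  simp only [h1, h2, Nat.add_sub_cancel]
  rw [hS m, C_add, mul_sum]
  simp only [Nat.cast_zero, zero_mul, mul_zero, C_0, zero_add, C_mul, mul_assoc, add_mul,
    sum_add_distrib]

theorem homSum_eval (c c' y w x : ℝ) (m : ℕ) : (homSum c c' y w m).eval x =
    ∑ p ∈ antidiagonal m,
      y ^ p.1 * w ^ p.2 / (p.1.factorial * p.2.factorial * (poch c p.1 * poch c' p.2)) *
      (x ^ p.1 * (1 - x) ^ p.2) := by
  simp [homSum, eval_finsetSum]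

theorem homSum_eval_zero (c c' y w : ℝ) (m : ℕ) :
    (homSum c c' y w m).eval 0 = w ^ m / (m.factorial * poch c' m) := by
  rw [homSum_eval, sum_eq_single (0, m)]
  · simp [poch_zero]
  · rintro ⟨j, k⟩ hp hne
    have : j ≠ 0 := by
      rintro rfl
      simp at hp; simp [hp] at hne
    simp [this]
  · simp

theorem homSum_swap (c c' y w x : ℝ) (m : ℕ) :
    (homSum c c' y w m).eval (1 - x) = (homSum c' c w y m).eval x := by
  rw [homSum_eval, homSum_eval, ← Nat.sum_antidiagonal_swap]
  refine sum_congr rfl fun p _ => ?_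
  simp only [Prod.fst_swap, Prod.snd_swap, sub_sub_cancel]
  ring

theorem homSum_neg (c c' y w x : ℝ) (m : ℕ) :
    (homSum c c' (-y) (-w) m).eval x = (-1) ^ m * (homSum c c' y w m).eval x := by
  rw [homSum_eval, homSum_eval, mul_sum]
  refine sum_congr rfl fun p hp => ?_
  rw [← mem_antidiagonal.mp hp, neg_pow y, neg_pow w, pow_add]
  ring

end HypergeometricOperator

/-! ### Jacobi polynomials as eigenfunctions, and their coefficients. -/

section JacobiPolynomial

open Polynomial Finset

/-- The Jacobi polynomial in the variable `(1 - x) / 2`. -/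
noncomputable def jacobiQ (α β : ℝ) (n : ℕ) : ℝ[X] :=
  C (poch (α + 1) n * poch (β + 1) n) * homSum (α + 1) (β + 1) (-1) 1 n

/-- At the point 1 - 2x the factors are 2x and 2(1 - x), whose powers of 2 cancel the 2^n of
Rodrigues; `poch_descPochhammer` turns the falling factorials of Leibniz's rule into quotients of
rising ones. -/
theorem jacobiQ_eval {α β : ℝ} (hα : -1 < α) (hβ : -1 < β) (n : ℕ) (x : ℝ) :
    (jacobiQ α β n).eval x = (jacobiP α β n).eval (1 - 2 * x) := by
  rw [jacobiQ, jacobiP, eval_mul, eval_mul, eval_C, eval_C, homSum_eval, eval_finsetSum,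
    ← Nat.sum_antidiagonal_swap, Nat.sum_antidiagonal_eq_sum_range_succ_mk, mul_sum, mul_sum]
  refine sum_congr rfl fun k hk => ?_
  have hkn : k ≤ n := Nat.lt_succ_iff.mp (mem_range.mp hk)
  have h1 := poch_ne_zero (by linarith : 0 < α + 1) (n - k)
  have h2 := poch_ne_zero (by linarith : 0 < β + 1) k
  have e1 := poch_descPochhammer α hkn
  have e2 := poch_descPochhammer β (Nat.sub_le n k)
  rw [Nat.sub_sub_self hkn] at e2
  have e3 : ((n.choose k : ℕ) : ℝ) * (k.factorial * (n - k).factorial) = n.factorial := by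
    rw [← Nat.choose_mul_factorial_mul_factorial hkn]; push_cast; ring
  have e4 : (-1 : ℝ) ^ n = (-1) ^ (n - k) * (-1) ^ k := by
    rw [← pow_add, Nat.sub_add_cancel hkn]
  have e5 : (2 : ℝ) ^ n = 2 ^ (n - k) * 2 ^ k := by
    rw [← pow_add, Nat.sub_add_cancel hkn]
  have e6 : (-1 : ℝ) ^ k * (-1) ^ k = 1 := by rw [← mul_pow]; simp
  simp only [Prod.fst_swap, Prod.snd_swap, eval_mul, eval_C, eval_pow, eval_sub, eval_add,
    eval_one, eval_X]
  rw [show 1 - (1 - 2 * x) = 2 * x by ring, show 1 + (1 - 2 * x) = 2 * (1 - x) by ring,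
    mul_pow, mul_pow, ← e1, ← e2, ← e3, e4, e5]
  have h3 : ((n.choose k : ℕ) : ℝ) ≠ 0 := by exact_mod_cast (Nat.choose_pos hkn).ne'
  field_simp
  rw [one_pow, pow_two, e6]; ring

theorem jacobiP_eval {α β : ℝ} (hα : -1 < α) (hβ : -1 < β) (n : ℕ) (x : ℝ) :
    (jacobiP α β n).eval x = (jacobiQ α β n).eval ((1 - x) / 2) := by
  rw [jacobiQ_eval hα hβ]; congr 1; ring

/-- Here y = -1 and w = 1, so the lower term of `hypOp_homSum_succ` has the factor y + w = 0. -/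
theorem hypOp_jacobiQ {α β : ℝ} (hα : -1 < α) (hβ : -1 < β) (n : ℕ) :
    hypOp (α + 1) (β + 1) (jacobiQ α β n) =
      C (-(n * (n + α + β + 1))) * jacobiQ α β n := by
  rw [jacobiQ, ← smul_eq_C_mul (a := poch (α + 1) n * poch (β + 1) n), map_smul]
  rcases n with _ | n
  · simp [hypOp_homSum_zero]
  · rw [hypOp_homSum_succ (by linarith) (by linarith), smul_eq_C_mul, smul_eq_C_mul,
      show (n : ℝ) + (α + 1 + (β + 1)) = (n + 1 : ℕ) + α + β + 1 by push_cast; ring]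
    push_cast
    simp only [neg_add_cancel, C_0, C_neg]
    ring

theorem jacobiQ_eval_zero {α β : ℝ} (hβ : -1 < β) (n : ℕ) :
    (jacobiQ α β n).eval 0 = poch (α + 1) n / n.factorial := by
  have h2 := poch_ne_zero (by linarith : 0 < β + 1) n
  rw [jacobiQ, eval_mul, eval_C, homSum_eval_zero]
  field_simp
  simp

theorem jacobiQ_eval_one_sub (α β : ℝ) (n : ℕ) (x : ℝ) :
    (jacobiQ α β n).eval (1 - x) = (-1) ^ n * (jacobiQ β α n).eval x := by
  rw [jacobiQ, jacobiQ, eval_mul, eval_mul, eval_C, eval_C, homSum_swap,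
    show (1 : ℝ) = - -1 by ring, homSum_neg]
  simp only [neg_neg]
  ring

theorem jacobiP_eval_neg {α β : ℝ} (hα : -1 < α) (hβ : -1 < β) (n : ℕ) (x : ℝ) :
    (jacobiP α β n).eval (-x) = (-1) ^ n * (jacobiP β α n).eval x := by
  rw [jacobiP_eval hα hβ, jacobiP_eval hβ hα, ← jacobiQ_eval_one_sub]
  congr 1; ring

theorem jacobiP_eval_one {α β : ℝ} (hα : -1 < α) (hβ : -1 < β) (n : ℕ) :
    (jacobiP α β n).eval 1 = poch (α + 1) n / n.factorial := by
  rw [jacobiP_eval hα hβ, sub_self, zero_div, jacobiQ_eval_zero hβ]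

theorem natDegree_jacobiQ_le (α β : ℝ) (n : ℕ) : (jacobiQ α β n).natDegree ≤ n := by
  rw [jacobiQ, homSum]
  refine (natDegree_C_mul_le _ _).trans (natDegree_sum_le_of_forall_le _ _ fun p hp => ?_)
  refine (natDegree_C_mul_le _ _).trans ?_
  have h1 : (1 - X : ℝ[X]).natDegree ≤ 1 := by compute_degree
  rw [← mem_antidiagonal.mp hp]
  refine natDegree_mul_le.trans (add_le_add (natDegree_X_pow_le _) ?_)
  exact natDegree_pow_le.trans (by nlinarith)

/-- The coefficients of the Jacobi polynomial in powers of `(1 - x) / 2`. -/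
theorem jacobiQ_coeff {α β : ℝ} (hα : -1 < α) (hβ : -1 < β) (n i : ℕ) :
    (jacobiQ α β n).coeff i * (n.factorial * i.factorial * poch (α + 1) i) =
      poch (α + 1) n * (poch (-n) i * poch (n + α + β + 1) i) := by
  induction i with
  | zero =>
    rw [coeff_zero_eq_eval_zero, jacobiQ_eval_zero hβ]
    simp [poch_zero]
    field_simp
  | succ i ih =>
    have h := coeff_succ_of_hypOp (hypOp_jacobiQ hα hβ n) i
    rw [poch_succ, poch_succ, poch_succ, Nat.factorial_succ]
    push_cast
    linear_combination (n.factorial * i.factorial * poch (α + 1) i) * h +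
      (i * (i - 1 + (α + 1 + (β + 1))) + (-(n * (n + α + β + 1)))) * ih

theorem poch_neg_natCast (n : ℕ) : poch (-n) n = (-1) ^ n * n.factorial := by
  rw [poch, ascPochhammer_eval_neg_eq_descPochhammer, descPochhammer_eval_eq_descFactorial,
    Nat.descFactorial_self]

theorem jacobiQ_coeff_self {α β : ℝ} (hα : -1 < α) (hβ : -1 < β) (n : ℕ) :
    (jacobiQ α β n).coeff n = (-1) ^ n * poch (n + α + β + 1) n / n.factorial := by
  have h := jacobiQ_coeff hα hβ n n
  have h1 := poch_ne_zero (by linarith : 0 < α + 1) n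
  have h2 : (n.factorial : ℝ) ≠ 0 := by positivity
  rw [poch_neg_natCast] at h
  rw [eq_div_iff h2]
  apply mul_right_cancel₀ (mul_ne_zero h2 h1)
  linear_combination h

end JacobiPolynomial

/-! ### Beta integrals, orthogonality and the norms of Jacobi polynomials. -/

section BetaMoments

open Polynomial Finset ProbabilityTheory intervalIntegral

theorem Gamma_add_natCast {a : ℝ} (ha : 0 < a) (n : ℕ) :
    Real.Gamma (a + n) = poch a n * Real.Gamma a := by
  induction n with
  | zero => simp [poch_zero]
  | succ n ih =>
    have : a + n ≠ 0 := by positivity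
    rw [poch_succ, Nat.cast_succ, ← add_assoc, Real.Gamma_add_one this, ih]; ring

theorem beta_add_natCast {a b : ℝ} (ha : 0 < a) (hb : 0 < b) (j k : ℕ) :
    beta (a + j) (b + k) = beta a b * (poch a j * poch b k / poch (a + b) (j + k)) := by
  have h := Gamma_add_natCast (add_pos ha hb) (j + k)
  push_cast at h
  rw [beta, beta, Gamma_add_natCast ha, Gamma_add_natCast hb,
    show a + j + (b + k) = a + b + (j + k) by ring, h]
  have := (Real.Gamma_pos_of_pos (add_pos ha hb)).ne'
  have := poch_ne_zero (add_pos ha hb) (j + k)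
  field_simp

theorem ofReal_rpow_mul_rpow {a b x : ℝ} (hx : x ∈ Set.uIcc (0 : ℝ) 1) :
    (x : ℂ) ^ ((a + 1 : ℝ) - 1 : ℂ) * (1 - x : ℂ) ^ ((b + 1 : ℝ) - 1 : ℂ) =
      ((x ^ a * (1 - x) ^ b : ℝ) : ℂ) := by
  rw [Set.uIcc_of_le zero_le_one] at hx
  rw [Complex.ofReal_mul, Complex.ofReal_cpow hx.1, Complex.ofReal_cpow (by linarith [hx.2])]
  push_cast
  simp

theorem intervalIntegrable_beta {a b : ℝ} (ha : -1 < a) (hb : -1 < b) :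
    IntervalIntegrable (fun x : ℝ => x ^ a * (1 - x) ^ b) volume 0 1 := by
  have h := Complex.betaIntegral_convergent (u := (a + 1 : ℝ)) (v := (b + 1 : ℝ))
    (by simp; linarith) (by simp; linarith)
  rw [intervalIntegrable_iff] at h ⊢
  have h2 := h.re
  refine h2.congr ?_
  filter_upwards [ae_restrict_mem measurableSet_uIoc] with x hx
  simp only [ofReal_rpow_mul_rpow (Set.uIoc_subset_uIcc hx)]
  simp

theorem integral_beta {a b : ℝ} (ha : -1 < a) (hb : -1 < b) :
    ∫ x in (0 : ℝ)..1, x ^ a * (1 - x) ^ b = beta (a + 1) (b + 1) := by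
  rw [beta_eq_betaIntegralReal _ _ (by linarith) (by linarith), Complex.betaIntegral,
    integral_congr (fun x hx => ofReal_rpow_mul_rpow hx), intervalIntegral.integral_ofReal]
  simp

theorem integral_beta_mul_pow {a b : ℝ} (ha : -1 < a) (hb : -1 < b) (j k : ℕ) :
    ∫ x in (0 : ℝ)..1, (x ^ j * (1 - x) ^ k) * (x ^ a * (1 - x) ^ b) =
      beta (a + 1) (b + 1) *
        (poch (a + 1) j * poch (b + 1) k / poch (a + 1 + (b + 1)) (j + k)) := by
  rw [← beta_add_natCast (by linarith) (by linarith), add_right_comm a, add_right_comm b,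
    ← integral_beta (by have : (0:ℝ) ≤ j := j.cast_nonneg
                        linarith) (by have : (0:ℝ) ≤ k := k.cast_nonneg
                                      linarith)]
  refine integral_congr_ae ?_
  have h1 : ∀ᵐ x : ℝ, x ≠ 1 := by simp [ae_iff]
  filter_upwards [h1] with x hx1 hx
  rw [Set.uIoc_of_le zero_le_one] at hx
  have h3 : 0 < 1 - x := by have := lt_of_le_of_ne hx.2 hx1; linarith
  rw [Real.rpow_add_natCast hx.1.ne', Real.rpow_add_natCast h3.ne']
  ring

theorem intervalIntegrable_mul_beta {a b : ℝ} (ha : -1 < a) (hb : -1 < b) {f : ℝ → ℝ}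
    (hf : Continuous f) :
    IntervalIntegrable (fun x : ℝ => f x * (x ^ a * (1 - x) ^ b)) volume 0 1 :=
  (intervalIntegrable_beta ha hb).continuousOn_mul hf.continuousOn

theorem ascPochhammer_comp_natDegree (c : ℝ) (i : ℕ) :
    ((ascPochhammer ℝ i).comp (X + C c)).natDegree = i := by
  rw [natDegree_comp, natDegree_X_add_C, mul_one, ascPochhammer_natDegree]

/-- Up to the sign (-1)^n this is the n-th forward difference at 0 of j ↦ (c + j)_i, a monic
polynomial of degree i. -/
theorem sum_choose_mul_poch (c : ℝ) {i n : ℕ} (hi : i ≤ n) :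
    ∑ j ∈ range (n + 1), (-1 : ℝ) ^ j * n.choose j * poch (c + j) i =
      if i = n then (-1 : ℝ) ^ n * n.factorial else 0 := by
  set p : ℝ[X] := (ascPochhammer ℝ i).comp (X + C c) with hp
  have hdeg : p.natDegree = i := ascPochhammer_comp_natDegree c i
  have hmon : p.Monic := (monic_ascPochhammer ℝ i).comp_X_add_C c
  have h := fwdDiff_iter_eq_sum_shift (1 : ℝ) p.eval n 0
  have e : ∑ j ∈ range (n + 1), (-1 : ℝ) ^ j * n.choose j * poch (c + j) i =
      (-1) ^ n * (fwdDiff (1 : ℝ))^[n] p.eval 0 := by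
    rw [h, mul_sum]
    refine sum_congr rfl fun j hj => ?_
    have hj' : j ≤ n := Nat.lt_succ_iff.mp (mem_range.mp hj)
    have h4 : (-1 : ℝ) ^ n = (-1) ^ (n - j) * (-1) ^ j := by
      rw [← pow_add, Nat.sub_add_cancel hj']
    have h6 : (-1 : ℝ) ^ (n - j) * (-1) ^ (n - j) = 1 := by rw [← mul_pow]; simp
    have h7 : p.eval (0 + j • (1 : ℝ)) = poch (c + j) i := by
      simp [hp, poch, add_comm]
    rw [h7, h4, zsmul_eq_mul]
    push_cast
    linear_combination (-((-1 : ℝ) ^ j * n.choose j * poch (c + j) i)) * h6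
  rw [e]
  split_ifs with hin
  · subst hin
    nth_rewrite 2 [← hdeg]
    rw [fwdDiff_iter_degree_eq_factorial, hmon.leadingCoeff, hdeg]
    simp
  · rw [fwdDiff_iter_eq_zero_of_degree_lt (by rw [hdeg]; omega)]
    simp

/-- Jacobi polynomials are orthogonal to lower powers. -/
theorem integral_jacobiQ_mul_pow {α β : ℝ} (hα : -1 < α) (hβ : -1 < β) {i n : ℕ} (hi : i ≤ n) :
    ∫ x in (0 : ℝ)..1, (jacobiQ α β n).eval x * x ^ i * (x ^ α * (1 - x) ^ β) =
      if i = n then (-1) ^ n * (beta (α + 1) (β + 1) *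
        (poch (α + 1) n * poch (β + 1) n / poch (α + 1 + (β + 1)) (2 * n))) else 0 := by
  have hc : 0 < α + 1 := by linarith
  have hc' : 0 < β + 1 := by linarith
  have e1 : ∀ x : ℝ, (jacobiQ α β n).eval x * x ^ i * (x ^ α * (1 - x) ^ β) =
      ∑ j ∈ range (n + 1), (poch (α + 1) n * poch (β + 1) n * ((-1) ^ j /
        (j.factorial * (n - j).factorial * (poch (α + 1) j * poch (β + 1) (n - j))))) *
        (x ^ (j + i) * (1 - x) ^ (n - j) * (x ^ α * (1 - x) ^ β)) := by
    intro x
    rw [jacobiQ, eval_mul, eval_C, homSum_eval, Nat.sum_antidiagonal_eq_sum_range_succ_mk,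
      mul_sum, sum_mul, sum_mul]
    refine sum_congr rfl fun j _ => ?_
    rw [one_pow, pow_add]; ring
  simp_rw [e1]
  rw [intervalIntegral.integral_finsetSum]
  swap
  · intro j _
    exact (intervalIntegrable_mul_beta hα hβ (by fun_prop)).const_mul _
  simp_rw [intervalIntegral.integral_const_mul, integral_beta_mul_pow hα hβ]
  -- The quotient of (α+1)_{j+i} by (α+1)_j leaves (α+1+j)_i, and the total degree n + i does not
  -- depend on j; what remains is an alternating binomial sum.
  have e2 : ∀ j ∈ range (n + 1), (poch (α + 1) n * poch (β + 1) n * ((-1) ^ j /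
        (j.factorial * (n - j).factorial * (poch (α + 1) j * poch (β + 1) (n - j))))) *
        (beta (α + 1) (β + 1) * (poch (α + 1) (j + i) * poch (β + 1) (n - j) /
          poch (α + 1 + (β + 1)) (j + i + (n - j)))) =
      beta (α + 1) (β + 1) * (poch (α + 1) n * poch (β + 1) n /
        (n.factorial * poch (α + 1 + (β + 1)) (n + i))) *
        ((-1) ^ j * n.choose j * poch (α + 1 + j) i) := by
    intro j hj
    have hj' : j ≤ n := Nat.lt_succ_iff.mp (mem_range.mp hj)
    have e3 : ((n.choose j : ℕ) : ℝ) * (j.factorial * (n - j).factorial) = n.factorial := by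
      rw [← Nat.choose_mul_factorial_mul_factorial hj']; push_cast; ring
    have h1 := poch_ne_zero hc j
    have h2 := poch_ne_zero hc' (n - j)
    have h3 : ((n.choose j : ℕ) : ℝ) ≠ 0 := by exact_mod_cast (Nat.choose_pos hj').ne'
    rw [show j + i + (n - j) = n + i by omega, poch_add, ← e3]
    field_simp
  rw [sum_congr rfl e2, ← mul_sum, sum_choose_mul_poch _ hi]
  split_ifs with hin
  · subst hin
    have : (i.factorial : ℝ) ≠ 0 := by positivity
    rw [← two_mul]
    field_simp
  · simp

theorem integral_comp_one_sub_two_mul (f : ℝ → ℝ) :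
    ∫ x in (-1 : ℝ)..1, f x = 2 * ∫ x in (0 : ℝ)..1, f (1 - 2 * x) := by
  rw [intervalIntegral.integral_comp_sub_mul f two_ne_zero 1]
  norm_num
  ring

theorem integral_mul_jacobiWeight (f : ℝ → ℝ) (α β : ℝ) :
    ∫ x in (-1 : ℝ)..1, f x * ((1 - x) ^ α * (1 + x) ^ β) =
      2 ^ (α + β + 1) * ∫ x in (0 : ℝ)..1, f (1 - 2 * x) * (x ^ α * (1 - x) ^ β) := by
  rw [integral_comp_one_sub_two_mul, ← intervalIntegral.integral_const_mul,
    ← intervalIntegral.integral_const_mul]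
  refine integral_congr fun x hx => ?_
  rw [Set.uIcc_of_le zero_le_one] at hx
  have h1 : 0 ≤ 1 - x := by linarith [hx.2]
  rw [show 1 - (1 - 2 * x) = 2 * x by ring, show 1 + (1 - 2 * x) = 2 * (1 - x) by ring,
    Real.mul_rpow two_pos.le hx.1, Real.mul_rpow two_pos.le h1,
    Real.rpow_add two_pos, Real.rpow_add two_pos, Real.rpow_one]
  ring

/-- The squared norm of the Jacobi polynomial. -/
theorem jacobiH_eq {α β : ℝ} (hα : -1 < α) (hβ : -1 < β) (n : ℕ) :
    jacobiH α β n = 2 ^ (α + β + 1) * beta (α + 1) (β + 1) *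
      (poch (n + α + β + 1) n * poch (α + 1) n * poch (β + 1) n /
        (n.factorial * poch (α + 1 + (β + 1)) (2 * n))) := by
  rw [jacobiH, integral_mul_jacobiWeight]
  simp_rw [← jacobiQ_eval hα hβ]
  have e1 : ∀ x : ℝ, (jacobiQ α β n).eval x ^ 2 * (x ^ α * (1 - x) ^ β) =
      ∑ i ∈ range (n + 1), (jacobiQ α β n).coeff i *
        ((jacobiQ α β n).eval x * x ^ i * (x ^ α * (1 - x) ^ β)) := by
    intro x
    have : (jacobiQ α β n).eval x = ∑ i ∈ range (n + 1), (jacobiQ α β n).coeff i * x ^ i :=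
      eval_eq_sum_range' (Nat.lt_succ_of_le (natDegree_jacobiQ_le α β n)) x
    rw [pow_two]
    nth_rewrite 1 [this]
    rw [sum_mul, sum_mul]
    exact sum_congr rfl fun i _ => by ring
  simp_rw [e1]
  rw [intervalIntegral.integral_finsetSum]
  swap
  · intro i _
    exact (intervalIntegrable_mul_beta hα hβ (by fun_prop)).const_mul _
  simp_rw [intervalIntegral.integral_const_mul]
  -- By orthogonality only the leading coefficient contributes.
  rw [sum_range_succ, sum_eq_zero, integral_jacobiQ_mul_pow hα hβ le_rfl, if_pos rfl,
    jacobiQ_coeff_self hα hβ]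
  · have h6 : (-1 : ℝ) ^ n * (-1) ^ n = 1 := by rw [← mul_pow]; simp
    linear_combination (2 ^ (α + β + 1) * beta (α + 1) (β + 1) *
      (poch (n + α + β + 1) n * poch (α + 1) n * poch (β + 1) n /
        (n.factorial * poch (α + 1 + (β + 1)) (2 * n)))) * h6
  · intro i hi
    have hi' := mem_range.mp hi
    rw [integral_jacobiQ_mul_pow hα hβ hi'.le, if_neg hi'.ne, mul_zero]

end BetaMoments

/-! ### The quadratic transformation and the bilinear product formula. -/

section ProductFormula

open Polynomial Finset

/-- With z = 1 - 2x the substitution is 1 - z², which suits the even ultraspherical polynomials. The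
factor 4 is the ratio of the eigenvalues of degree 2n for (l, l) and degree n for (l, -1/2). -/
theorem hypOp_comp_quadratic (c : ℝ) (p : ℝ[X]) :
    hypOp c c (p.comp (4 * X * (1 - X))) =
      4 * (hypOp c (1 / 2) p).comp (4 * X * (1 - X)) := by
  have h : (C (1 / 2) : ℝ[X]) * 2 = 1 := by
    rw [← C_ofNat, ← C_mul]; norm_num
  simp only [hypOp_apply, derivative_comp, derivative_mul, derivative_sub, derivative_one,
    derivative_X, derivative_add, mul_comp, sub_comp, add_comp, X_comp, C_comp, one_comp,
    derivative_ofNat, derivative_zero, C_add]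
  linear_combination (8 * X * (1 - X) * (derivative p).comp (4 * X * (1 - X))) * h

/-- The quadratic transformation of even ultraspherical polynomials. -/
theorem jacobiQ_two_mul {l : ℝ} (hl : -1 < l) (n : ℕ) (x : ℝ) :
    (jacobiQ l l (2 * n)).eval x * (poch (l + 1) n / n.factorial) =
      (jacobiQ l (-1 / 2) n).eval (4 * x * (1 - x)) *
        (poch (l + 1) (2 * n) / (2 * n).factorial) := by
  have h1 := hypOp_jacobiQ hl hl (2 * n)
  have h2 : hypOp (l + 1) (l + 1) ((jacobiQ l (-1 / 2) n).comp (4 * X * (1 - X))) =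
      C (-((2 * n : ℕ) * ((2 * n : ℕ) + l + l + 1))) *
        (jacobiQ l (-1 / 2) n).comp (4 * X * (1 - X)) := by
    have h3 := hypOp_jacobiQ hl (by norm_num : (-1 : ℝ) < -1 / 2) n
    rw [show (-1 / 2 + 1 : ℝ) = 1 / 2 by norm_num] at h3
    rw [hypOp_comp_quadratic, h3, mul_comp, C_comp, ← mul_assoc, ← C_ofNat, ← C_mul]
    congr 2
    push_cast; ring
  have h := eval_mul_eval_of_hypOp (by linarith) h1 h2 x
  simpa [jacobiQ_eval_zero hl, jacobiQ_eval_zero (by norm_num : (-1 : ℝ) < -1 / 2),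
    eval_comp] using h

/-- Even ultraspherical polynomials in powers of the variable. -/
theorem jacobiP_two_mul_eval {l : ℝ} (hl : -1 < l) (n : ℕ) (z : ℝ) :
    (jacobiP l l (2 * n)).eval z =
      (-1) ^ n * (poch (l + 1) (2 * n) / (2 * n).factorial) * (n.factorial / poch (l + 1) n) *
        ∑ m ∈ range (n + 1), (jacobiQ (-1 / 2) l n).coeff m * z ^ (2 * m) := by
  have h := jacobiQ_two_mul hl n ((1 - z) / 2)
  have h1 := poch_ne_zero (by linarith : 0 < l + 1) n
  have h2 : (n.factorial : ℝ) ≠ 0 := by positivity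
  -- The quadratic argument is 1 - z²; reflection replaces it by z² and exchanges the parameters l
  -- and -1/2.
  rw [← jacobiP_eval hl hl,
    show 4 * ((1 - z) / 2) * (1 - (1 - z) / 2) = 1 - z ^ 2 by ring,
    jacobiQ_eval_one_sub,
    eval_eq_sum_range' (Nat.lt_succ_of_le (natDegree_jacobiQ_le (-1 / 2) l n))] at h
  simp_rw [pow_mul]
  field_simp
  field_simp at h
  linarith

/-- The bilinear product formula for Jacobi polynomials. -/
theorem sum_homSum_eq {α β : ℝ} (hα : -1 < α) (hβ : -1 < β) (n : ℕ) (x y : ℝ) :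
    ∑ m ∈ range (n + 1), poch (-n) m * poch (n + α + β + 1) m *
        (homSum (α + 1) (β + 1) y (1 - y) m).eval x =
      (-1) ^ n * n.factorial ^ 2 / (poch (α + 1) n * poch (β + 1) n) *
        ((jacobiQ α β n).eval x * (jacobiQ α β n).eval y) := by
  have hc : 0 < α + 1 := by linarith
  have hc' : 0 < β + 1 := by linarith
  obtain ⟨D, hD⟩ : ∃ D : ℕ → ℝ, ∀ m, poch (-n) m * poch (n + α + β + 1) m = D m :=
    ⟨_, fun _ => rfl⟩
  simp_rw [hD]
  have hDs : ∀ m, D (m + 1) = (m * (m + α + β + 1) - n * (n + α + β + 1)) * D m := by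
    intro m; simp only [← hD, poch_succ]; ring
  -- This makes the sum end at m = n: after the index shift in `e1` no boundary term is left.
  have hDn : D (n + 1) = 0 := by rw [hDs]; ring
  set F : ℝ[X] := ∑ m ∈ range (n + 1), C (D m) * homSum (α + 1) (β + 1) y (1 - y) m with hF
  have hFop : hypOp (α + 1) (β + 1) F = C (-(n * (n + α + β + 1))) * F := by
    set S := homSum (α + 1) (β + 1) y (1 - y) with hS
    have e0 : ∀ m, hypOp (α + 1) (β + 1) (C (D (m + 1)) * S (m + 1)) =
        C (D (m + 1)) * S m -
          C (D (m + 1) * ((m + 1 : ℕ) * ((m + 1 : ℕ) + α + β + 1))) * S (m + 1) := by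
      intro m
      rw [← smul_eq_C_mul, map_smul, hS, hypOp_homSum_succ hc hc', smul_eq_C_mul,
        show (m : ℝ) + (α + 1 + (β + 1)) = (m + 1 : ℕ) + α + β + 1 by push_cast; ring]
      simp only [add_sub_cancel, C_1, C_mul, Nat.cast_succ]
      ring
    have e1 : hypOp (α + 1) (β + 1) F =
        ∑ m ∈ range (n + 1), C (D (m + 1)) * S m -
          ∑ m ∈ range (n + 1), C (D m * (m * (m + α + β + 1))) * S m := by
      rw [hF, sum_range_succ', map_add, map_sum, sum_congr rfl fun m _ => e0 m,
        sum_range_succ _ n, hDn, sum_range_succ' (fun m => C (D m * (m * (m + α + β + 1))) * S m),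
        sum_sub_distrib, ← smul_eq_C_mul (a := D 0), map_smul, hS, hypOp_homSum_zero]
      simp
    rw [e1, hF, mul_sum, ← sum_sub_distrib]
    refine sum_congr rfl fun m _ => ?_
    rw [hDs, ← sub_mul, ← C_sub, ← mul_assoc (C _), ← C_mul]
    congr 2
    ring
  -- At x = 0 each homogeneous sum reduces to its power of 1 - y, and the result is the expansion of
  -- the reflected Jacobi polynomial at 1 - y.
  have hF0 : F.eval 0 = n.factorial / poch (β + 1) n * ((-1) ^ n * (jacobiQ α β n).eval y) := by
    have e : (-1) ^ n * (jacobiQ α β n).eval y = (jacobiQ β α n).eval (1 - y) := by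
      rw [← jacobiQ_eval_one_sub β α]
    rw [e, eval_eq_sum_range' (Nat.lt_succ_of_le (natDegree_jacobiQ_le β α n)), mul_sum, hF,
      eval_finsetSum]
    refine sum_congr rfl fun m _ => ?_
    have h2 := jacobiQ_coeff hβ hα n m
    have h3 := poch_ne_zero hc' m
    have h4 := poch_ne_zero hc' n
    rw [eval_mul, eval_C, homSum_eval_zero]
    rw [← hD, add_right_comm (n : ℝ)]
    field_simp
    linear_combination (-(1 - y) ^ m) * h2
  have h := eval_mul_eval_of_hypOp hc hFop (hypOp_jacobiQ hα hβ n) x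
  rw [hF0, jacobiQ_eval_zero hβ] at h
  have hFx : F.eval x = ∑ m ∈ range (n + 1), D m *
      (homSum (α + 1) (β + 1) y (1 - y) m).eval x := by
    simp [hF, eval_finsetSum]
  rw [← hFx]
  have h3 := poch_ne_zero hc n
  have h4 := poch_ne_zero hc' n
  have h5 : (n.factorial : ℝ) ≠ 0 := by positivity
  field_simp
  field_simp at h
  linear_combination h

end ProductFormula

/-! ### Matching the normalising constants. -/

section Constants

open ProbabilityTheory

/-- For n = 0 the base need not be positive, but the product is empty. This matters at α = β = -1/2,
where s = α + β + 1 = 0. -/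
theorem poch_natCast_add_pos {s : ℝ} (hs : -1 < s) (n : ℕ) : 0 < poch (n + s) n := by
  rcases n with _ | n
  · simp [poch_zero]
  · refine poch_pos ?_ _
    have : (0 : ℝ) ≤ n := n.cast_nonneg
    push_cast; linarith

theorem jacobiH_pos {α β : ℝ} (hα : -1 / 2 ≤ α) (hβ : -1 / 2 ≤ β) (n : ℕ) :
    0 < jacobiH α β n := by
  rw [jacobiH_eq (by linarith) (by linarith), show (n : ℝ) + α + β + 1 = n + (α + β + 1) by ring]
  have h1 := beta_pos (by linarith : 0 < α + 1) (by linarith : 0 < β + 1)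
  have h2 := poch_natCast_add_pos (by linarith : -1 < α + β + 1) n
  have h3 := poch_pos (by linarith : 0 < α + 1) n
  have h4 := poch_pos (by linarith : 0 < β + 1) n
  have h5 := poch_pos (by linarith : 0 < α + 1 + (β + 1)) (2 * n)
  positivity

/-- This is the case n = 0, comparing the total masses of the two weights; it is Legendre's
duplication formula at α + β + 3/2. -/
theorem reductionConst_mul {α β : ℝ} (hα : -1 / 2 ≤ α) (hβ : -1 / 2 ≤ β) :
    reductionConst α β * (2 ^ (α + β + 1) * beta (α + 1) (β + 1)) =
      2 ^ ((α + β + 1 / 2) + (α + β + 1 / 2) + 1) *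
        beta ((α + β + 1 / 2) + 1) ((α + β + 1 / 2) + 1) := by
  have h1 := (Real.Gamma_pos_of_pos (by linarith : 0 < α + 1)).ne'
  have h2 := (Real.Gamma_pos_of_pos (by linarith : 0 < β + 1)).ne'
  have h3 := (Real.Gamma_pos_of_pos (by linarith : 0 < α + β + 2)).ne'
  have h4 := (Real.Gamma_pos_of_pos (by linarith : 0 < 2 * (α + β + 3 / 2))).ne'
  have h5 : (2 : ℝ) ^ (α + β + 1) ≠ 0 := (Real.rpow_pos_of_pos two_pos _).ne'
  have h := Real.Gamma_mul_Gamma_add_half (α + β + 3 / 2)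
  rw [show α + β + 3 / 2 + 1 / 2 = α + β + 2 by ring] at h
  have h6 : (2 : ℝ) ^ ((α + β + 1 / 2) + (α + β + 1 / 2) + 1) *
      2 ^ (1 - 2 * (α + β + 3 / 2)) = 1 := by
    rw [← Real.rpow_add two_pos, ← Real.rpow_zero 2]; congr 1; ring
  rw [reductionConst, beta, beta, show α + 1 + (β + 1) = α + β + 2 by ring,
    show α + β + 1 / 2 + 1 + (α + β + 1 / 2 + 1) = 2 * (α + β + 3 / 2) by ring,
    show α + β + 1 / 2 + 1 = α + β + 3 / 2 by ring]
  generalize (2 : ℝ) ^ ((α + β + 1 / 2) + (α + β + 1 / 2) + 1) = A at *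
  generalize Real.Gamma (α + β + 3 / 2) = G1 at *
  generalize Real.Gamma (α + β + 2) = G2 at *
  generalize Real.Gamma (2 * (α + β + 3 / 2)) = G3 at *
  field_simp
  linear_combination (-A * G1) * h -
(√Real.pi * G1 * G3) * h6

/-- One factor of the square is P_{2n}^{l,l}(1), the other comes from the product formula. After
`reductionConst_mul`, duplication splits the rising factorials of length 2n and 4n until everything
cancels. -/
theorem reductionConst_mul_div_jacobiH {α β : ℝ} (hα : -1 / 2 ≤ α) (hβ : -1 / 2 ≤ β) (n : ℕ) :
    reductionConst α β *
      ((poch ((α + β + 1 / 2) + 1) (2 * n) / (2 * n).factorial) ^ 2 *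
        (poch (1 / 2) n * n.factorial ^ 2 /
          (poch ((α + β + 1 / 2) + 1) n * (poch (α + 1) n * poch (β + 1) n))) /
        jacobiH (α + β + 1 / 2) (α + β + 1 / 2) (2 * n)) =
      1 / jacobiH α β n := by
  have h := reductionConst_mul hα hβ
  rw [jacobiH_eq (by linarith) (by linarith), jacobiH_eq (by linarith) (by linarith), ← h]
  have p1 := beta_pos (by linarith : 0 < α + 1) (by linarith : 0 < β + 1)
  have p2 : (2 : ℝ) ^ (α + β + 1) ≠ 0 := (Real.rpow_pos_of_pos two_pos _).ne'
  have p3 : reductionConst α β ≠ 0 := by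
    have h1 := (Real.Gamma_pos_of_pos (by linarith : 0 < α + 1))
    have h2 := (Real.Gamma_pos_of_pos (by linarith : 0 < β + 1))
    have h3 := (Real.Gamma_pos_of_pos (by linarith : 0 < α + β + 3 / 2))
    have h4 := Real.pi_pos
    rw [reductionConst]; positivity
  rw [show α + β + 1 / 2 + 1 + (α + β + 1 / 2 + 1) = 2 * (α + β + 1 + 1 / 2) by ring,
    show ((2 * n : ℕ) : ℝ) + (α + β + 1 / 2) + (α + β + 1 / 2) + 1 = 2 * (n + (α + β + 1)) by
      push_cast; ring,
    show α + β + 1 / 2 + 1 = α + β + 1 + 1 / 2 by ring,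
    show α + 1 + (β + 1) = α + β + 1 + 1 by ring, poch_two_mul _ n, poch_two_mul _ (2 * n),
    show α + β + 1 + 1 / 2 + 1 / 2 = α + β + 1 + 1 by ring, ← poch_half n, two_mul n,
    poch_add _ n n, poch_add _ n n,
    show (n : ℝ) + α + β + 1 = n + (α + β + 1) by ring,
    show (α + β + 1 + 1 / 2) + n = n + (α + β + 1) + 1 / 2 by ring]
  generalize hs : α + β + 1 = s
  have hs0 : 0 ≤ s := by linarith
  have q1 := poch_natCast_add_pos (by linarith : -1 < s) n
  have q2 := poch_pos (by linarith : 0 < α + 1) n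
  have q3 := poch_pos (by linarith : 0 < β + 1) n
  have q4 := poch_pos (by linarith : 0 < s + 1) n
  have q5 := poch_pos (by linarith : 0 < s + 1 / 2) n
  have q6 := poch_pos (by positivity : 0 < s + 1 + n) n
  have q7 := poch_pos (by positivity : 0 < n + s + 1 / 2) n
  have q8 := poch_pos (by norm_num : (0 : ℝ) < 1 / 2) n
  rw [hs] at p2
  have q9 : (4 : ℝ) ^ (n + n) = 4 ^ n * 4 ^ n := pow_add _ _ _
  rw [q9]
  generalize poch (s + 1 / 2) n = a at *
  generalize poch (n + s + 1 / 2) n = b at *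
  field_simp

end Constants

/-! ### The measures Π_α and their moments. -/

section JacobiPi

open Finset ProbabilityTheory intervalIntegral

theorem one_sub_sq_rpow {u : ℝ} (hu : u ∈ Set.Icc (-1 : ℝ) 1) (a : ℝ) :
    (1 - u ^ 2) ^ a = (1 - u) ^ a * (1 + u) ^ a := by
  rw [← Real.mul_rpow (by linarith [hu.2]) (by linarith [hu.1])]
  congr 1; ring

theorem integral_one_sub_sq_rpow {a : ℝ} (ha : -1 < a) :
    ∫ u in (-1 : ℝ)..1, (1 - u ^ 2) ^ a = 2 ^ (a + a + 1) * beta (a + 1) (a + 1) := by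
  have h := integral_mul_jacobiWeight (fun _ => 1) a a
  simp only [one_mul] at h
  rw [← integral_beta ha ha, ← h]
  refine integral_congr fun u hu => ?_
  rw [Set.uIcc_of_le (by norm_num)] at hu
  exact one_sub_sq_rpow hu a

theorem intervalIntegrable_one_sub_sq_rpow {a : ℝ} (ha : -1 < a) :
    IntervalIntegrable (fun u : ℝ => (1 - u ^ 2) ^ a) volume (-1) 1 := by
  -- The integral of a nonintegrable function is 0 by convention, so a nonzero value forces
  -- integrability.
  apply intervalIntegrable_of_integral_ne_zero
  rw [integral_one_sub_sq_rpow ha]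
  have := beta_pos (by linarith : 0 < a + 1) (by linarith : 0 < a + 1)
  positivity

/-- The density of `jacobiPi α` for `α > -1/2`. -/
noncomputable def jacobiPiDensity (α u : ℝ) : ℝ :=
  Real.Gamma (α + 1) / (Real.sqrt Real.pi * Real.Gamma (α + 1 / 2)) * (1 - u ^ 2) ^ (α - 1 / 2)

theorem jacobiPi_of_ne {α : ℝ} (h : α ≠ -1 / 2) : jacobiPi α =
    (volume.restrict (Set.Icc (-1) 1)).withDensity fun u =>
      ENNReal.ofReal (jacobiPiDensity α u) := by
  rw [jacobiPi, if_neg h]; rfl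

theorem jacobiPi_neg_half : jacobiPi (-1 / 2) =
    (2⁻¹ : ENNReal) • (Measure.dirac (-1) + Measure.dirac 1) := by
  rw [jacobiPi, if_pos rfl]

theorem measurable_jacobiPiDensity (α : ℝ) : Measurable (jacobiPiDensity α) := by
  unfold jacobiPiDensity; fun_prop

theorem jacobiPiDensity_nonneg {α u : ℝ} (hα : -1 / 2 < α) (hu : u ∈ Set.Icc (-1 : ℝ) 1) :
    0 ≤ jacobiPiDensity α u := by
  have h1 := Real.Gamma_pos_of_pos (by linarith : 0 < α + 1)
  have h2 := Real.Gamma_pos_of_pos (by linarith : 0 < α + 1 / 2)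
  have h3 : 0 ≤ 1 - u ^ 2 := by nlinarith [hu.1, hu.2]
  unfold jacobiPiDensity
  positivity

theorem intervalIntegrable_jacobiPiDensity {α : ℝ} (hα : -1 / 2 < α) :
    IntervalIntegrable (jacobiPiDensity α) volume (-1) 1 :=
  (intervalIntegrable_one_sub_sq_rpow (by linarith)).const_mul _

theorem integral_jacobiPiDensity {α : ℝ} (hα : -1 / 2 < α) :
    ∫ u in (-1 : ℝ)..1, jacobiPiDensity α u = 1 := by
  unfold jacobiPiDensity
  rw [intervalIntegral.integral_const_mul, integral_one_sub_sq_rpow (by linarith), beta]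
  have h1 := (Real.Gamma_pos_of_pos (by linarith : 0 < α + 1)).ne'
  have h2 := (Real.Gamma_pos_of_pos (by linarith : 0 < α + 1 / 2)).ne'
  have h3 := (Real.Gamma_pos_of_pos (by linarith : 0 < 2 * (α + 1 / 2))).ne'
  have h4 : √Real.pi ≠ 0 := (Real.sqrt_pos.mpr Real.pi_pos).ne'
  have h := Real.Gamma_mul_Gamma_add_half (α + 1 / 2)
  rw [show α + 1 / 2 + 1 / 2 = α + 1 by ring] at h
  have h6 : (2 : ℝ) ^ (α - 1 / 2 + (α - 1 / 2) + 1) * 2 ^ (1 - 2 * (α + 1 / 2)) = 1 := by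
    rw [← Real.rpow_add two_pos, ← Real.rpow_zero 2]; congr 1; ring
  rw [show α - 1 / 2 + 1 = α + 1 / 2 by ring,
    show α + 1 / 2 + (α + 1 / 2) = 2 * (α + 1 / 2) by ring]
  generalize (2 : ℝ) ^ (α - 1 / 2 + (α - 1 / 2) + 1) = A at *
  generalize Real.Gamma (α + 1 / 2) = G1 at *
  generalize Real.Gamma (α + 1) = G2 at *
  generalize Real.Gamma (2 * (α + 1 / 2)) = G3 at *
  field_simp
  linear_combination A * h + G3 * √Real.pi * h6

theorem integral_jacobiPi {α : ℝ} (hα : -1 / 2 < α) (f : ℝ → ℝ) :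
    ∫ u, f u ∂jacobiPi α = ∫ u in (-1 : ℝ)..1, f u * jacobiPiDensity α u := by
  rw [jacobiPi_of_ne hα.ne', integral_withDensity_eq_integral_toReal_smul
    (measurable_jacobiPiDensity α).ennreal_ofReal (by simp),
    intervalIntegral.integral_of_le (by norm_num), ← integral_Icc_eq_integral_Ioc]
  refine setIntegral_congr_fun measurableSet_Icc fun u hu => ?_
  rw [ENNReal.toReal_ofReal (jacobiPiDensity_nonneg hα hu), smul_eq_mul, mul_comm]

theorem isFiniteMeasure_jacobiPi {α : ℝ} (hα : -1 / 2 ≤ α) : IsFiniteMeasure (jacobiPi α) := by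
  rcases hα.eq_or_lt with rfl | hα
  · rw [jacobiPi_neg_half]
    exact Measure.smul_finite _ (by simp)
  · rw [jacobiPi_of_ne hα.ne']
    apply isFiniteMeasure_withDensity_ofReal
    have h := intervalIntegrable_jacobiPiDensity hα
    rw [intervalIntegrable_iff_integrableOn_Icc_of_le (by norm_num)] at h
    exact h.2

theorem ae_jacobiPi_mem_Icc (α : ℝ) : ∀ᵐ u ∂jacobiPi α, u ∈ Set.Icc (-1 : ℝ) 1 := by
  by_cases h : α = -1 / 2
  · subst h
    rw [jacobiPi_neg_half]
    refine Measure.ae_smul_measure ?_ _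
    rw [ae_add_measure_iff, ae_dirac_eq, ae_dirac_eq]
    simp
  · rw [jacobiPi_of_ne h]
    exact (withDensity_absolutelyContinuous _ _).ae_le (ae_restrict_mem measurableSet_Icc)

theorem integral_jacobiPi_neg_half (f : ℝ → ℝ) :
    ∫ u, f u ∂jacobiPi (-1 / 2) = (f (-1) + f 1) / 2 := by
  have h : ∀ a : ℝ, Integrable f (Measure.dirac a) := fun a => by
    apply integrable_dirac
    simp
  rw [jacobiPi_neg_half, MeasureTheory.integral_smul_measure, integral_add_measure (h _) (h _),
    integral_dirac, integral_dirac]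
  simp
  ring

theorem integral_odd_pow_jacobiPi {α : ℝ} (hα : -1 / 2 ≤ α) {j : ℕ} (hj : Odd j) :
    ∫ u, u ^ j ∂jacobiPi α = 0 := by
  rcases hα.eq_or_lt with rfl | hα
  · rw [integral_jacobiPi_neg_half, hj.neg_one_pow]; simp
  · rw [integral_jacobiPi hα]
    have h := intervalIntegral.integral_comp_neg (a := -1) (b := 1)
      (fun u : ℝ => u ^ j * jacobiPiDensity α u)
    have h2 : ∀ u : ℝ, (-u) ^ j * jacobiPiDensity α (-u) = -(u ^ j * jacobiPiDensity α u) := by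
      intro u
      rw [hj.neg_pow, jacobiPiDensity, neg_sq, ← jacobiPiDensity, neg_mul]
    simp only [h2, neg_neg, intervalIntegral.integral_neg] at h
    linarith

/-- For α > -1/2, integrating the derivative of u^(2j+1) (1 - u²)^(α+1/2), which vanishes at ±1,
gives the ratio (j + 1/2)/(j + α + 1) of successive even moments. At α = -1/2 all even moments are
1. -/
theorem integral_even_pow_jacobiPi {α : ℝ} (hα : -1 / 2 ≤ α) (j : ℕ) :
    ∫ u, u ^ (2 * j) ∂jacobiPi α = poch (1 / 2) j / poch (α + 1) j := by
  rcases hα.eq_or_lt with rfl | hα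
  · rw [integral_jacobiPi_neg_half, show (-1 / 2 + 1 : ℝ) = 1 / 2 by norm_num,
      div_self (poch_ne_zero (by norm_num) j), (even_two_mul j).neg_one_pow]
    norm_num
  · induction j with
    | zero => simp [integral_jacobiPi hα, integral_jacobiPiDensity hα, poch_zero]
    | succ j ih =>
      have hint : ∀ k : ℕ, IntervalIntegrable (fun u : ℝ => u ^ k * jacobiPiDensity α u)
          volume (-1) 1 := fun k =>
        (intervalIntegrable_jacobiPiDensity hα).continuousOn_mul (continuous_pow k).continuousOn
      set K := Real.Gamma (α + 1) / (Real.sqrt Real.pi * Real.Gamma (α + 1 / 2)) with hK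
      have hd : ∀ u ∈ Set.Ioo (-1 : ℝ) 1, HasDerivAt
          (fun u : ℝ => u ^ (2 * j + 1) * (K * (1 - u ^ 2) ^ (α + 1 / 2)))
          ((2 * j + 1) * (u ^ (2 * j) * jacobiPiDensity α u) -
            (2 * j + 2 * α + 2) * (u ^ (2 * (j + 1)) * jacobiPiDensity α u)) u := by
        intro u hu
        have hp : 0 < 1 - u ^ 2 := by nlinarith [hu.1, hu.2]
        have h1 : HasDerivAt (fun u : ℝ => 1 - u ^ 2) (-(2 * u)) u := by
          simpa using (hasDerivAt_pow 2 u).const_sub 1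
        have h2 := (h1.rpow_const (p := α + 1 / 2) (Or.inl hp.ne')).const_mul K
        have h3 := (hasDerivAt_pow (2 * j + 1) u).mul h2
        refine h3.congr_deriv ?_
        rw [jacobiPiDensity, ← hK, show α + 1 / 2 - 1 = α - 1 / 2 by ring,
          show α + 1 / 2 = (α - 1 / 2) + 1 by ring, Real.rpow_add_one hp.ne',
          Nat.add_sub_cancel, show 2 * (j + 1) = 2 * j + 2 by ring]
        push_cast
        ring
      have hcont : Continuous fun u : ℝ => u ^ (2 * j + 1) * (K * (1 - u ^ 2) ^ (α + 1 / 2)) := by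
        have : Continuous fun u : ℝ => (1 - u ^ 2) ^ (α + 1 / 2) :=
          (by fun_prop : Continuous fun u : ℝ => 1 - u ^ 2).rpow_const
            fun _ => Or.inr (by linarith)
        fun_prop
      have h := integral_eq_sub_of_hasDerivAt_of_le (by norm_num) hcont.continuousOn hd
        (((hint _).const_mul _).sub ((hint _).const_mul _))
      have hz : (0 : ℝ) ^ (α + 1 / 2) = 0 := Real.zero_rpow (by linarith)
      rw [intervalIntegral.integral_sub ((hint _).const_mul _) ((hint _).const_mul _),
        intervalIntegral.integral_const_mul, intervalIntegral.integral_const_mul,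
        ← integral_jacobiPi hα, ← integral_jacobiPi hα, ih] at h
      norm_num [hz] at h
      have h1 := poch_ne_zero (by linarith : 0 < α + 1) j
      have h2 : α + 1 + j ≠ 0 := by
        have : (0 : ℝ) ≤ j := j.cast_nonneg
        linarith
      rw [poch_succ, poch_succ]
      field_simp at h ⊢
      linear_combination (-1) * h

theorem ae_jacobiPi_prod_mem {α β : ℝ} (hα : -1 / 2 ≤ α) (hβ : -1 / 2 ≤ β) :
    ∀ᵐ p ∂(jacobiPi α).prod (jacobiPi β), p ∈ Set.Icc (-1 : ℝ) 1 ×ˢ Set.Icc (-1 : ℝ) 1 := by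
  have := isFiniteMeasure_jacobiPi hα
  have := isFiniteMeasure_jacobiPi hβ
  filter_upwards [Measure.quasiMeasurePreserving_fst.ae (ae_jacobiPi_mem_Icc α),
    Measure.quasiMeasurePreserving_snd.ae (ae_jacobiPi_mem_Icc β)] with p h1 h2
  exact ⟨h1, h2⟩

theorem integrable_jacobiPi_prod {α β : ℝ} (hα : -1 / 2 ≤ α) (hβ : -1 / 2 ≤ β) {f : ℝ × ℝ → ℝ}
    (hf : Continuous f) : Integrable f ((jacobiPi α).prod (jacobiPi β)) := by
  have := isFiniteMeasure_jacobiPi hα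
  have := isFiniteMeasure_jacobiPi hβ
  obtain ⟨B, hB⟩ := ((isCompact_Icc (a := (-1 : ℝ)) (b := 1)).prod
    (isCompact_Icc (a := (-1 : ℝ)) (b := 1))).exists_bound_of_continuousOn hf.continuousOn
  refine Integrable.of_bound hf.aestronglyMeasurable B ?_
  filter_upwards [ae_jacobiPi_prod_mem hα hβ] with p hp using hB p hp

theorem integral_add_pow_jacobiPi {α β : ℝ} (hα : -1 / 2 ≤ α) (hβ : -1 / 2 ≤ β) (p q : ℝ)
    (n : ℕ) :
    ∫ z : ℝ × ℝ, (z.1 * p + z.2 * q) ^ n ∂(jacobiPi α).prod (jacobiPi β) =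
      ∑ m ∈ antidiagonal n, n.choose m.1 * (p ^ m.1 * q ^ m.2) *
        ((∫ u, u ^ m.1 ∂jacobiPi α) * ∫ v, v ^ m.2 ∂jacobiPi β) := by
  have := isFiniteMeasure_jacobiPi hα
  have := isFiniteMeasure_jacobiPi hβ
  have e : ∀ z : ℝ × ℝ, (z.1 * p + z.2 * q) ^ n = ∑ m ∈ antidiagonal n,
      n.choose m.1 * (p ^ m.1 * q ^ m.2) * (z.1 ^ m.1 * z.2 ^ m.2) := by
    intro z
    rw [add_pow, Nat.sum_antidiagonal_eq_sum_range_succ_mk]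
    refine sum_congr rfl fun i _ => ?_
    rw [mul_pow, mul_pow]; ring
  simp_rw [e]
  rw [integral_finsetSum _ fun m _ => integrable_jacobiPi_prod hα hβ (by fun_prop)]
  refine sum_congr rfl fun m _ => ?_
  rw [MeasureTheory.integral_const_mul, integral_prod_mul (fun u : ℝ => u ^ m.1) (fun v : ℝ => v ^ m.2)]

theorem integral_add_pow_jacobiPi_odd {α β : ℝ} (hα : -1 / 2 ≤ α) (hβ : -1 / 2 ≤ β) (p q : ℝ)
    {n : ℕ} (hn : Odd n) :
    ∫ z : ℝ × ℝ, (z.1 * p + z.2 * q) ^ n ∂(jacobiPi α).prod (jacobiPi β) = 0 := by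
  rw [integral_add_pow_jacobiPi hα hβ]
  refine sum_eq_zero fun m hm => ?_
  rw [← mem_antidiagonal.mp hm, Nat.odd_add] at hn
  rcases Nat.even_or_odd m.1 with h | h
  · have h2 : Odd m.2 := by
      rw [← Nat.not_even_iff_odd]; intro h3
      exact (Nat.not_odd_iff_even.mpr h) (hn.mpr h3)
    rw [integral_odd_pow_jacobiPi hβ h2]; ring
  · rw [integral_odd_pow_jacobiPi hα h]; ring

/-- In the binomial expansion only pairs of even exponents survive; since (1/2)_a = (2a)!/(4^a a!),
the binomial coefficients and moments combine into the coefficients of `homSum`. -/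
theorem integral_add_pow_jacobiPi_even {α β : ℝ} (hα : -1 / 2 ≤ α) (hβ : -1 / 2 ≤ β)
    {p q x y w : ℝ} (hp : p ^ 2 = y * x) (hq : q ^ 2 = w * (1 - x)) (n : ℕ) :
    ∫ z : ℝ × ℝ, (z.1 * p + z.2 * q) ^ (2 * n) ∂(jacobiPi α).prod (jacobiPi β) =
      poch (1 / 2) n * n.factorial * (homSum (α + 1) (β + 1) y w n).eval x := by
  rw [integral_add_pow_jacobiPi hα hβ, homSum_eval, mul_sum]
  symm
  -- Pairs outside the image of (a, b) ↦ (2a, 2b) have both exponents odd and contribute 0.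
  refine sum_of_injOn (fun m : ℕ × ℕ => (2 * m.1, 2 * m.2)) ?_ ?_ ?_ ?_
  · rintro ⟨a, b⟩ _ ⟨c, d⟩ _ h
    simpa using h
  · rintro ⟨a, b⟩ h
    simp at h ⊢
    omega
  · rintro ⟨a, b⟩ h hne
    rcases Nat.even_or_odd a with ha | ha
    · exfalso
      apply hne
      obtain ⟨c, rfl⟩ := ha
      simp at h
      refine ⟨(c, n - c), ?_, ?_⟩
      · simp; omega
      · simp; omega
    · simp only [integral_odd_pow_jacobiPi hα ha]; ring
  · rintro ⟨a, b⟩ h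
    have hab : a + b = n := by simpa using h
    simp only
    rw [integral_even_pow_jacobiPi hα, integral_even_pow_jacobiPi hβ, pow_mul, pow_mul, hp, hq,
      mul_pow, mul_pow]
    have e1 := poch_half a
    have e2 := poch_half b
    have e3 := poch_half n
    have e4 : (((2 * n).choose (2 * a) : ℕ) : ℝ) * ((2 * a).factorial * (2 * b).factorial) =
        (2 * n).factorial := by
      rw [← Nat.choose_mul_factorial_mul_factorial (by omega : 2 * a ≤ 2 * n),
        show 2 * n - 2 * a = 2 * b by omega]
      push_cast; ring
    have e5 : (4 : ℝ) ^ n = 4 ^ a * 4 ^ b := by rw [← hab, pow_add]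
    rw [← e1, ← e2, ← e3, e5] at e4
    have e6 : (((2 * n).choose (2 * a) : ℕ) : ℝ) * (poch (1 / 2) a * poch (1 / 2) b) *
        (a.factorial * b.factorial) = poch (1 / 2) n * n.factorial := by
      have : (4 : ℝ) ^ a * 4 ^ b ≠ 0 := by positivity
      apply mul_right_cancel₀ this
      linear_combination e4
    rw [← e6]
    have h1 := poch_ne_zero (by linarith : 0 < α + 1) a
    have h2 := poch_ne_zero (by linarith : 0 < β + 1) b
    field_simp

end JacobiPi

/-! ### Uniform bounds and summability of the heat series. -/

section Summability

open Polynomial Finset Filter Topology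

/-- There are n + 1 ≤ 2^n terms, each at most 2^n because (c)_j ≥ 2^(-j) when c ≥ 1/2. -/
theorem abs_homSum_eval_le {c c' x : ℝ} (hc : 1 / 2 ≤ c) (hc' : 1 / 2 ≤ c')
    (hx : x ∈ Set.Icc (0 : ℝ) 1) (n : ℕ) : |(homSum c c' (-1) 1 n).eval x| ≤ 4 ^ n := by
  have e : (n + 1 : ℝ) * 2 ^ n ≤ 4 ^ n := by
    have h1 : n + 1 ≤ 2 ^ n := Nat.lt_two_pow_self
    have h2 : (n + 1 : ℝ) ≤ 2 ^ n := by exact_mod_cast h1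
    calc (n + 1 : ℝ) * 2 ^ n ≤ 2 ^ n * 2 ^ n := by gcongr
      _ = 4 ^ n := by rw [← mul_pow]; norm_num
  refine le_trans ?_ e
  rw [homSum_eval]
  refine (abs_sum_le_sum_abs _ _).trans ?_
  refine (sum_le_card_nsmul _ _ (2 ^ n) fun p hp => ?_).trans ?_
  · rw [← mem_antidiagonal.mp hp]
    have h1 := le_poch (by norm_num) hc p.1
    have h2 := le_poch (by norm_num) hc' p.2
    have h3 : (1 : ℝ) ≤ p.1.factorial := by exact_mod_cast p.1.factorial_pos
    have h4 : (1 : ℝ) ≤ p.2.factorial := by exact_mod_cast p.2.factorial_pos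
    have h0 : (0 : ℝ) < (1 / 2) ^ p.1 := by positivity
    have h0' : (0 : ℝ) < (1 / 2) ^ p.2 := by positivity
    have h5 : |x ^ p.1 * (1 - x) ^ p.2| ≤ 1 := by
      rw [abs_mul, abs_pow, abs_pow]
      refine mul_le_one₀ (pow_le_one₀ (abs_nonneg _) ?_) (by positivity)
        (pow_le_one₀ (abs_nonneg _) ?_)
      · rw [abs_le]; constructor <;> linarith [hx.1, hx.2]
      · rw [abs_le]; constructor <;> linarith [hx.1, hx.2]
    have h6 : (1 / 2 : ℝ) ^ (p.1 + p.2) ≤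
        p.1.factorial * p.2.factorial * (poch c p.1 * poch c' p.2) := by
      calc (1 / 2 : ℝ) ^ (p.1 + p.2) = 1 * 1 * ((1 / 2) ^ p.1 * (1 / 2) ^ p.2) := by
            rw [pow_add]; ring
        _ ≤ _ := by gcongr; exact h0.le.trans h1
    rw [abs_mul, one_pow, mul_one, abs_div, abs_neg_one_pow]
    have h7 : 0 < p.1.factorial * p.2.factorial * (poch c p.1 * poch c' p.2) :=
      lt_of_lt_of_le (by positivity) h6
    rw [abs_of_pos h7]
    calc _ ≤ 1 / (1 / 2 : ℝ) ^ (p.1 + p.2) * 1 := by gcongr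
      _ = 2 ^ (p.1 + p.2) := by simp
  · simp

theorem abs_jacobiP_eval_le {α β x : ℝ} (hα : -1 / 2 ≤ α) (hβ : -1 / 2 ≤ β)
    (hx : x ∈ Set.Icc (-1 : ℝ) 1) (n : ℕ) :
    |(jacobiP α β n).eval x| ≤ poch (α + 1) n * poch (β + 1) n * 4 ^ n := by
  have h1 := poch_pos (by linarith : 0 < α + 1) n
  have h2 := poch_pos (by linarith : 0 < β + 1) n
  rw [jacobiP_eval (by linarith) (by linarith), jacobiQ, eval_mul, eval_C, abs_mul,
    abs_of_pos (by positivity)]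
  gcongr
  exact abs_homSum_eval_le (by linarith) (by linarith)
    ⟨by linarith [hx.2], by linarith [hx.1]⟩ n

/-- A summable bound for the terms of the heat kernel series. -/
noncomputable def jacobiHeatBound (α β t : ℝ) (n : ℕ) : ℝ :=
  (jacobiH α β 0)⁻¹ * (16 * (|α| + |β| + 2 + 2 * n) ^ 5 * Real.exp (-t * n)) ^ n

theorem tendsto_mul_pow_mul_exp (K : ℝ) {t : ℝ} (ht : 0 < t) :
    Tendsto (fun n : ℕ => 16 * (K + 2 * n) ^ 5 * Real.exp (-t * n)) atTop (𝓝 0) := by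
  have h1 : Tendsto (fun n : ℕ => t / 2 * (K + 2 * n)) atTop atTop := by
    refine Tendsto.const_mul_atTop (by positivity) ?_
    exact tendsto_atTop_add_const_left _ _
      (tendsto_natCast_atTop_atTop.const_mul_atTop two_pos)
  have h2 := ((Real.tendsto_pow_mul_exp_neg_atTop_nhds_zero 5).comp h1).const_mul
    (16 * (2 / t) ^ 5 * Real.exp (t / 2 * K))
  rw [mul_zero] at h2
  refine h2.congr fun n => ?_
  have e : Real.exp (-t * n) = Real.exp (t / 2 * K) * Real.exp (-(t / 2 * (K + 2 * n))) := by
    rw [← Real.exp_add]; congr 1; ring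
  simp only [Function.comp]
  rw [e, mul_pow, div_pow, div_pow]
  field_simp

/-- The base of the n-th power tends to 0, so the terms are eventually dominated by a geometric
series of ratio 1/2. -/
theorem summable_jacobiHeatBound (α β : ℝ) {t : ℝ} (ht : 0 < t) :
    Summable (jacobiHeatBound α β t) := by
  refine Summable.mul_left _ ?_
  refine Summable.of_norm_bounded_eventually_nat
    (summable_geometric_of_lt_one (by norm_num) (by norm_num : (1 / 2 : ℝ) < 1)) ?_
  filter_upwards [(tendsto_mul_pow_mul_exp (|α| + |β| + 2) ht).eventually
    (gt_mem_nhds (by norm_num : (0 : ℝ) < 1 / 2))] with n hn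
  rw [norm_pow]
  refine pow_le_pow_left₀ (norm_nonneg _) ?_ n
  rw [Real.norm_of_nonneg (by positivity)]
  exact hn.le

/-- The fifth power collects two rising factorials of length n, one of length 2n, and n!, all
bounded by powers of M; 16 is the square of the 4 in `abs_jacobiP_eval_le`. The exponential bound
uses α + β + 1 ≥ 0. -/
theorem abs_jacobiHeatTerm_le {α β t x y : ℝ} (hα : -1 / 2 ≤ α) (hβ : -1 / 2 ≤ β) (ht : 0 < t)
    (hx : x ∈ Set.Icc (-1 : ℝ) 1) (hy : y ∈ Set.Icc (-1 : ℝ) 1) (n : ℕ) :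
    |jacobiHeatTerm α β t x y n| ≤ jacobiHeatBound α β t n := by
  have hH := jacobiH_pos hα hβ n
  have hH0 := jacobiH_pos hα hβ 0
  have p1 := poch_pos (by linarith : 0 < α + 1) n
  have p2 := poch_pos (by linarith : 0 < β + 1) n
  have p3 := poch_pos (by linarith : 0 < α + 1 + (β + 1)) (2 * n)
  set M := |α| + |β| + 2 + 2 * n with hM
  have hn0 : (0 : ℝ) ≤ n := n.cast_nonneg
  have hαa := le_abs_self α
  have hβa := le_abs_self β
  have hα0 := abs_nonneg α
  have hβ0 := abs_nonneg β
  have q1 : poch (α + 1) n ≤ M ^ n := poch_le (by linarith) (by linarith)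
  have q2 : poch (β + 1) n ≤ M ^ n := poch_le (by linarith) (by linarith)
  have q3 : poch (α + 1 + (β + 1)) (2 * n) ≤ M ^ (2 * n) :=
    poch_le (by linarith) (by push_cast; linarith)
  have q4 : (n.factorial : ℝ) ≤ M ^ n := by
    calc (n.factorial : ℝ) ≤ (n : ℝ) ^ n := by exact_mod_cast Nat.factorial_le_pow n
      _ ≤ M ^ n := by gcongr; linarith
  have q5 : 1 ≤ poch (n + α + β + 1) n := by
    rcases n with _ | n
    · simp [poch_zero]
    · have : (0 : ℝ) ≤ n := n.cast_nonneg
      have := le_poch zero_le_one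
        (by push_cast; linarith : (1 : ℝ) ≤ (n + 1 : ℕ) + α + β + 1) (n + 1)
      simpa using this
  have hHe : (poch (α + 1) n * poch (β + 1) n) ^ 2 / jacobiH α β n =
      (jacobiH α β 0)⁻¹ * (poch (α + 1) n * poch (β + 1) n * n.factorial *
        poch (α + 1 + (β + 1)) (2 * n) / poch (n + α + β + 1) n) := by
    rw [jacobiH_eq (by linarith) (by linarith) n, jacobiH_eq (by linarith) (by linarith) 0]
    simp only [poch_zero, mul_zero, Nat.factorial_zero, Nat.cast_one, mul_one, div_one]
    have r1 := ProbabilityTheory.beta_pos (by linarith : 0 < α + 1) (by linarith : 0 < β + 1)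
    have r2 : (2 : ℝ) ^ (α + β + 1) ≠ 0 := (Real.rpow_pos_of_pos two_pos _).ne'
    have r3 : poch (n + α + β + 1) n ≠ 0 := by linarith
    field_simp
  have hE : Real.exp (-t * (n * (n + α + β + 1))) ≤ Real.exp (-t * n) ^ n := by
    rw [← Real.exp_nat_mul, Real.exp_le_exp]
    have : 0 ≤ t * n * (α + β + 1) := by
      have : 0 ≤ α + β + 1 := by linarith
      positivity
    linarith
  rw [jacobiHeatTerm, abs_mul, abs_div, abs_mul, abs_of_pos hH, abs_of_pos (Real.exp_pos _)]
  calc _ ≤ Real.exp (-t * n) ^ n * ((poch (α + 1) n * poch (β + 1) n * 4 ^ n) *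
          (poch (α + 1) n * poch (β + 1) n * 4 ^ n) / jacobiH α β n) := by
        gcongr
        · exact abs_jacobiP_eval_le hα hβ hx n
        · exact abs_jacobiP_eval_le hα hβ hy n
    _ = Real.exp (-t * n) ^ n * 16 ^ n * ((jacobiH α β 0)⁻¹ *
          (poch (α + 1) n * poch (β + 1) n * n.factorial *
          poch (α + 1 + (β + 1)) (2 * n) / poch (n + α + β + 1) n)) := by
        rw [← hHe, show (16 : ℝ) = 4 * 4 by norm_num, mul_pow]; ring
    _ ≤ Real.exp (-t * n) ^ n * 16 ^ n * ((jacobiH α β 0)⁻¹ *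
          (M ^ n * M ^ n * M ^ n * M ^ (2 * n) / 1)) := by gcongr
    _ = jacobiHeatBound α β t n := by
        rw [jacobiHeatBound, ← hM, mul_pow, mul_pow, ← pow_mul, ← pow_add, ← pow_add, ← pow_add,
          show n + n + n + 2 * n = 5 * n by ring]
        ring

theorem summable_jacobiHeatTerm {α β t x y : ℝ} (hα : -1 / 2 ≤ α) (hβ : -1 / 2 ≤ β) (ht : 0 < t)
    (hx : x ∈ Set.Icc (-1 : ℝ) 1) (hy : y ∈ Set.Icc (-1 : ℝ) 1) :
    Summable (jacobiHeatTerm α β t x y) :=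
  (summable_jacobiHeatBound α β ht).of_norm_bounded
    fun n => abs_jacobiHeatTerm_le hα hβ ht hx hy n

end Summability

/-! ### Integrals of ultraspherical polynomials at the reduction point. -/

section Reduction

open Polynomial Finset

/-- The sines and cosines of the half angles are nonnegative, so the absolute value is at most its
value at u = v = 1, which is cos((θ - φ)/2). -/
theorem reductionPoint_mem_Icc {θ φ u v : ℝ} (hθ : θ ∈ Set.Icc 0 Real.pi)
    (hφ : φ ∈ Set.Icc 0 Real.pi) (hu : u ∈ Set.Icc (-1 : ℝ) 1) (hv : v ∈ Set.Icc (-1 : ℝ) 1) :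
    reductionPoint θ φ u v ∈ Set.Icc (-1 : ℝ) 1 := by
  have hpi := Real.pi_pos
  have h1 : 0 ≤ Real.sin (θ / 2) * Real.sin (φ / 2) :=
    mul_nonneg (Real.sin_nonneg_of_nonneg_of_le_pi (by linarith [hθ.1]) (by linarith [hθ.2]))
      (Real.sin_nonneg_of_nonneg_of_le_pi (by linarith [hφ.1]) (by linarith [hφ.2]))
  have h2 : 0 ≤ Real.cos (θ / 2) * Real.cos (φ / 2) :=
    mul_nonneg (Real.cos_nonneg_of_mem_Icc ⟨by linarith [hθ.1], by linarith [hθ.2]⟩)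
      (Real.cos_nonneg_of_mem_Icc ⟨by linarith [hφ.1], by linarith [hφ.2]⟩)
  have h3 := Real.cos_le_one (θ / 2 - φ / 2)
  rw [Real.cos_sub] at h3
  rw [reductionPoint, mul_assoc, mul_assoc]
  obtain ⟨hu1, hu2⟩ := hu
  obtain ⟨hv1, hv2⟩ := hv
  constructor <;> nlinarith

/-- Odd ultraspherical polynomials integrate to zero. -/
theorem integral_jacobiP_odd {α β l : ℝ} (hα : -1 / 2 ≤ α) (hβ : -1 / 2 ≤ β) (hl : -1 < l)
    (p q : ℝ) {n : ℕ} (hn : Odd n) :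
    ∫ z : ℝ × ℝ, (jacobiP l l n).eval (z.1 * p + z.2 * q) ∂(jacobiPi α).prod (jacobiPi β) = 0 := by
  -- Replacing the polynomial by its odd part removes the even powers without computing any
  -- coefficients.
  have e : ∀ z : ℝ, (jacobiP l l n).eval z = ∑ i ∈ range ((jacobiP l l n).natDegree + 1),
      (jacobiP l l n).coeff i * ((z ^ i - (-z) ^ i) / 2) := by
    intro z
    have h := jacobiP_eval_neg hl hl n z
    rw [hn.neg_one_pow] at h
    have h2 : (jacobiP l l n).eval z =
        ((jacobiP l l n).eval z - (jacobiP l l n).eval (-z)) / 2 := by rw [h]; ring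
    rw [h2, eval_eq_sum_range, eval_eq_sum_range, ← sum_sub_distrib, sum_div]
    exact sum_congr rfl fun i _ => by ring
  simp_rw [e]
  rw [integral_finsetSum _ fun i _ => integrable_jacobiPi_prod hα hβ (by fun_prop)]
  refine sum_eq_zero fun i _ => ?_
  rw [integral_const_mul]
  rcases Nat.even_or_odd i with hi | hi
  · simp_rw [hi.neg_pow, sub_self, zero_div, integral_zero, mul_zero]
  · simp_rw [hi.neg_pow]
    have : ∀ w : ℝ, (w - -w) / 2 = w := fun w => by ring
    simp_rw [this]
    rw [integral_add_pow_jacobiPi_odd hα hβ p q hi, mul_zero]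

/-- The product formula: an integral of an even ultraspherical polynomial is a product of two
Jacobi polynomials. -/
theorem integral_jacobiP_even {α β : ℝ} (hα : -1 / 2 ≤ α) (hβ : -1 / 2 ≤ β) {p q x y : ℝ}
    (hp : p ^ 2 = y * x) (hq : q ^ 2 = (1 - y) * (1 - x)) (n : ℕ) :
    ∫ z : ℝ × ℝ, (jacobiP (α + β + 1 / 2) (α + β + 1 / 2) (2 * n)).eval (z.1 * p + z.2 * q)
        ∂(jacobiPi α).prod (jacobiPi β) =
      poch ((α + β + 1 / 2) + 1) (2 * n) / (2 * n).factorial *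
        (poch (1 / 2) n * n.factorial ^ 2 /
          (poch ((α + β + 1 / 2) + 1) n * (poch (α + 1) n * poch (β + 1) n))) *
        ((jacobiQ α β n).eval x * (jacobiQ α β n).eval y) := by
  have hl : -1 < α + β + 1 / 2 := by linarith
  simp_rw [jacobiP_two_mul_eval hl]
  rw [integral_const_mul,
    integral_finsetSum _ fun i _ => integrable_jacobiPi_prod hα hβ (by fun_prop)]
  simp_rw [integral_const_mul, integral_add_pow_jacobiPi_even hα hβ hp hq]
  have h := sum_homSum_eq (by linarith : -1 < α) (by linarith : -1 < β) n x y
  -- The factor (1/2)_m m! from the moments cancels the denominator of the m-th coefficient, leaving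
  -- the weights of `sum_homSum_eq`.
  have e : ∀ m ∈ range (n + 1), (jacobiQ (-1 / 2) (α + β + 1 / 2) n).coeff m *
      (poch (1 / 2) m * m.factorial * (homSum (α + 1) (β + 1) y (1 - y) m).eval x) =
      poch (1 / 2) n / n.factorial * (poch (-n) m * poch (n + α + β + 1) m *
        (homSum (α + 1) (β + 1) y (1 - y) m).eval x) := by
    intro m _
    have h1 := jacobiQ_coeff (by norm_num : (-1 : ℝ) < -1 / 2) hl n m
    rw [show (-1 / 2 + 1 : ℝ) = 1 / 2 by norm_num,
      show (n : ℝ) + -1 / 2 + (α + β + 1 / 2) + 1 = n + α + β + 1 by ring] at h1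
    generalize (jacobiQ (-1 / 2) (α + β + 1 / 2) n).coeff m = b at *
    field_simp
    linear_combination (homSum (α + 1) (β + 1) y (1 - y) m).eval x * h1
  rw [sum_congr rfl e, ← mul_sum, h]
  have h6 : (-1 : ℝ) ^ n * (-1) ^ n = 1 := by rw [← mul_pow]; simp
  have h1 := poch_ne_zero (by linarith : 0 < α + β + 1 / 2 + 1) n
  have h2 := poch_ne_zero (by linarith : 0 < α + 1) n
  have h3 := poch_ne_zero (by linarith : 0 < β + 1) n
  have h4 : (n.factorial : ℝ) ≠ 0 := by positivity
  generalize poch (α + β + 1 / 2 + 1) n = a at *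
  field_simp
  rw [pow_two, h6, one_mul]

end Reduction

/-! ### Termwise integration and the reduction formula. -/

theorem mainTheorem4 (α β : ℝ) (hα : -1 / 2 ≤ α) (hβ : -1 / 2 ≤ β)
    (θ φ t : ℝ) (hθ : θ ∈ Set.Icc 0 Real.pi) (hφ : φ ∈ Set.Icc 0 Real.pi) (ht : 0 < t) :
    -- the series defining the kernels on both sides converge
    Summable (jacobiHeatTerm α β t (Real.cos θ) (Real.cos φ)) ∧
    (∀ u ∈ Set.Icc (-1 : ℝ) 1, ∀ v ∈ Set.Icc (-1 : ℝ) 1,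
      Summable (jacobiHeatTerm (α + β + 1 / 2) (α + β + 1 / 2) (t / 4)
        (reductionPoint θ φ u v) 1)) ∧
    -- the double integral converges
    Integrable (fun p : ℝ × ℝ =>
      jacobiHeatKernel (α + β + 1 / 2) (α + β + 1 / 2) (t / 4) (reductionPoint θ φ p.1 p.2) 1)
      ((jacobiPi α).prod (jacobiPi β)) ∧
    -- the reduction formula
    jacobiHeatKernel α β t (Real.cos θ) (Real.cos φ) =
      reductionConst α β *
        ∫ p : ℝ × ℝ,
          jacobiHeatKernel (α + β + 1 / 2) (α + β + 1 / 2) (t / 4)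
            (reductionPoint θ φ p.1 p.2) 1
          ∂((jacobiPi α).prod (jacobiPi β)) := by
  have := isFiniteMeasure_jacobiPi hα
  have := isFiniteMeasure_jacobiPi hβ
  have hl : -1 / 2 ≤ α + β + 1 / 2 := by linarith
  have ht4 : 0 < t / 4 := by positivity
  have hone : (1 : ℝ) ∈ Set.Icc (-1 : ℝ) 1 := by norm_num
  have hS : ∀ u ∈ Set.Icc (-1 : ℝ) 1, ∀ v ∈ Set.Icc (-1 : ℝ) 1,
      Summable (jacobiHeatTerm (α + β + 1 / 2) (α + β + 1 / 2) (t / 4)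
        (reductionPoint θ φ u v) 1) := fun u hu v hv =>
    summable_jacobiHeatTerm hl hl ht4 (reductionPoint_mem_Icc hθ hφ hu hv) hone
  set μ := (jacobiPi α).prod (jacobiPi β) with hμ
  set F : ℕ → ℝ × ℝ → ℝ := fun n p => jacobiHeatTerm (α + β + 1 / 2) (α + β + 1 / 2) (t / 4)
    (reductionPoint θ φ p.1 p.2) 1 n with hF
  have hFcont : ∀ n, Continuous (F n) := fun n => by
    simp only [hF, jacobiHeatTerm, reductionPoint]; fun_prop
  have hFb : ∀ n, ∀ᵐ p ∂μ,
      ‖F n p‖ ≤ jacobiHeatBound (α + β + 1 / 2) (α + β + 1 / 2) (t / 4) n := fun n => by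
    filter_upwards [ae_jacobiPi_prod_mem hα hβ] with p hp
    exact abs_jacobiHeatTerm_le hl hl ht4 (reductionPoint_mem_Icc hθ hφ hp.1 hp.2) hone n
  have hFint : ∀ n, Integrable (F n) μ := fun n => integrable_jacobiPi_prod hα hβ (hFcont n)
  have hbsum := summable_jacobiHeatBound (α + β + 1 / 2) (α + β + 1 / 2) ht4
  have hsum : HasSum (fun n => ∫ p, F n p ∂μ) (∫ p : ℝ × ℝ,
      jacobiHeatKernel (α + β + 1 / 2) (α + β + 1 / 2) (t / 4)
        (reductionPoint θ φ p.1 p.2) 1 ∂μ) := by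
    -- The dominating terms do not depend on (u, v), hence are integrable because the product
    -- measure is finite.
    refine hasSum_integral_of_dominated_convergence
      (fun n _ => jacobiHeatBound (α + β + 1 / 2) (α + β + 1 / 2) (t / 4) n)
      (fun n => (hFcont n).aestronglyMeasurable) hFb
      (Filter.Eventually.of_forall fun _ => hbsum) (integrable_const _) ?_
    filter_upwards [ae_jacobiPi_prod_mem hα hβ] with p hp
    exact (hS _ hp.1 _ hp.2).hasSum
  refine ⟨summable_jacobiHeatTerm hα hβ ht ⟨Real.neg_one_le_cos _, Real.cos_le_one _⟩
    ⟨Real.neg_one_le_cos _, Real.cos_le_one _⟩, hS, ?_, ?_⟩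
  · refine Integrable.of_bound (C := ∑' n,
      jacobiHeatBound (α + β + 1 / 2) (α + β + 1 / 2) (t / 4) n) ?_ ?_
    · exact (Measurable.tsum fun n => (hFcont n).measurable).aestronglyMeasurable
    · filter_upwards [ae_all_iff.mpr hFb] with p hp
      exact tsum_of_norm_bounded hbsum.hasSum hp
  · have hsum2 := hsum.mul_left (reductionConst α β)
    have hodd : ∀ m ∉ Set.range (fun n : ℕ => 2 * n), reductionConst α β * ∫ p, F m p ∂μ = 0 := by
      intro m hm
      have hm' : Odd m := by
        rw [← Nat.not_even_iff_odd]
        rintro ⟨k, rfl⟩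
        exact hm ⟨k, two_mul k⟩
      have := integral_jacobiP_odd hα hβ (by linarith : -1 < α + β + 1 / 2)
        (Real.sin (θ / 2) * Real.sin (φ / 2)) (Real.cos (θ / 2) * Real.cos (φ / 2)) hm'
      simp only [hF, jacobiHeatTerm, reductionPoint, mul_div_assoc, mul_assoc] at this ⊢
      rw [integral_const_mul, integral_mul_const, this]
      simp
    -- The odd terms vanish, so the series may be indexed by degrees 2n.
    rw [← (mul_right_injective₀ two_ne_zero).hasSum_iff hodd] at hsum2
    rw [jacobiHeatKernel, ← hsum2.tsum_eq]
    refine tsum_congr fun n => ?_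
    -- The product formula applies with x = sin²(θ/2) and y = sin²(φ/2).
    have hp : (Real.sin (θ / 2) * Real.sin (φ / 2)) ^ 2 =
        ((1 - Real.cos φ) / 2) * ((1 - Real.cos θ) / 2) := by
      rw [mul_pow, Real.sin_sq_eq_half_sub, Real.sin_sq_eq_half_sub]; ring_nf
    have hq : (Real.cos (θ / 2) * Real.cos (φ / 2)) ^ 2 =
        (1 - (1 - Real.cos φ) / 2) * (1 - (1 - Real.cos θ) / 2) := by
      rw [mul_pow, Real.cos_sq, Real.cos_sq]; ring_nf
    have h := integral_jacobiP_even hα hβ hp hq n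
    have hc := reductionConst_mul_div_jacobiH hα hβ n
    have hexp : -(t / 4) * ((2 * n : ℕ) * ((2 * n : ℕ) + (α + β + 1 / 2) + (α + β + 1 / 2) + 1)) =
        -t * (n * (n + α + β + 1)) := by push_cast; ring
    simp only [Function.comp, hF, jacobiHeatTerm, hexp,
      jacobiP_eval_one (by linarith : -1 < α + β + 1 / 2) (by linarith : -1 < α + β + 1 / 2), reductionPoint, mul_assoc, mul_div_assoc] at h ⊢
    rw [integral_const_mul, integral_mul_const, h, jacobiP_eval (by linarith) (by linarith),
      jacobiP_eval (by linarith) (by linarith)]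
    linear_combination (-(Real.exp (-t * (n * (n + α + β + 1))) *
      ((jacobiQ α β n).eval ((1 - Real.cos θ) / 2) *
        (jacobiQ α β n).eval ((1 - Real.cos φ) / 2)))) * hc
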